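/- Let $e^1,\dots,e^7$ be the dual of the standard basis of $\mathbb R^7=\operatorname{Im}\mathbb O$, write $e^{ijk}=e^i\wedge e^j\wedge e^k$, and let \[\varphi=e^{123}+e^{145}+e^{167}+e^{246}-e^{257}-e^{347}-e^{356}.\] Let $\langle\cdot,\cdot\rangle$ be the standard scalar product on $\mathbb R^7$, let $\star$ be the Hodge star operator defined by $\langle\cdot,\cdot\rangle$ and the volume form $e^1\wedge\dots\wedge e^7$, and let $\times$ be the cross product on $\mathbb R^7$ given by $\langle X\times Y,Z\rangle=\varphi(X,Y,Z)$. Let $\iota\colon S^6\hookrightarrow\mathbb R^7$ be the unit sphere with the induced metric $g$ and the unit normal vector field $N$, $N_p=p$, and for $p\in S^6$ and $X\in T_pS^6$ let $JX=N\times X\in T_pS^6$. Put \[\sigma=g(J\,\cdot,\cdot),\qquad \psi_+=\iota^*\varphi,\qquad \psi_-=-\iota^*(N\lrcorner\star\varphi).\] Then $\sigma,\psi_\pm$ give a nearly Kähler structure on $S^6$, that is: 1. $(g,J)$ is an almost Hermitian structure on $S^6$ with fundamental two-form $\sigma$, and $(\sigma,\psi_\pm)$ is an $\mathrm{SU}(3)$-structure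 compatible with it: $\sigma,\psi_\pm$ are smooth, and at each point there is an orthonormal basis $e_1,Je_1,e_2,Je_2,e_3,Je_3$ of the tangent space such that, with dual basis $a_1,b_1,a_2,b_2,a_3,b_3$, one has $\sigma=\sum_k a_k\wedge b_k$ and $\psi_++i\psi_-=(a_1+ib_1)\wedge(a_2+ib_2)\wedge(a_3+ib_3)$. 2. The nearly Kähler structure equations hold: \[d\sigma=3\psi_+,\qquad d\psi_-=-2\,\sigma\wedge\sigma.\] 3. $(S^6,g,J)$ is a nearly Kähler manifold: $(\nabla_XJ)X=0$ for all vector fields $X$, where $\nabla$ is the Levi-Civita connection of $g$. -/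

import Mathlib

open scoped Manifold ContDiff TensorProduct

noncomputable section

namespace NearlyKahlerSphere

/-! ### Exterior algebra of a real topological vector space -/

section Algebra

/-- The decomposable form `θ₁ ∧ ⋯ ∧ θ_k`, i.e. `(v₁, …, v_k) ↦ det (θ_b (v_a))`. -/
def covectorWedge {V : Type*} [AddCommGroup V] [Module ℝ V] [TopologicalSpace V] {k : ℕ}
    (θ : Fin k → V →L[ℝ] ℝ) : V [⋀^Fin k]→L[ℝ] ℝ :=
  { (Matrix.detRowAlternating (n := Fin k) (R := ℝ)).compLinearMap
      (LinearMap.pi fun b => (θ b : V →ₗ[ℝ] ℝ)) with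
    cont := by
      change Continuous fun v : Fin k → V => Matrix.det (Matrix.of fun a b => θ b (v a))
      refine Continuous.matrix_det (continuous_matrix fun a b => ?_)
      exact (θ b).continuous.comp (continuous_apply a) }

/-- The exterior product, as a sum over shuffles:
`(α ∧ β)(v) = ∑_σ sign σ · α(v_{σ 1}, …, v_{σ k}) β(v_{σ (k+1)}, …, v_{σ (k+l)})`. -/
def wedge {V : Type*} [AddCommGroup V] [Module ℝ V] [TopologicalSpace V] {k l : ℕ}
    (α : V [⋀^Fin k]→L[ℝ] ℝ) (β : V [⋀^Fin l]→L[ℝ] ℝ) : V [⋀^Fin (k + l)]→L[ℝ] ℝ :=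
  { ((LinearMap.mul' ℝ ℝ).compAlternatingMap
      (α.toAlternatingMap.domCoprod β.toAlternatingMap)).domDomCongr finSumFinEquiv with
    cont := by
      change Continuous fun v : Fin (k + l) → V => LinearMap.mul' ℝ ℝ
        ((α.toAlternatingMap.domCoprod β.toAlternatingMap) fun i => v (finSumFinEquiv i))
      simp only [AlternatingMap.domCoprod_apply, sum_apply, map_sum]
      refine continuous_finsetSum _ fun s _ => ?_
      induction s using Quotient.inductionOn' with
      | _ s =>
        change Continuous fun v : Fin (k + l) → V => LinearMap.mul' ℝ ℝ
          ((Equiv.Perm.sign s : ℤˣ) •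
            ((α fun i => v (finSumFinEquiv (s (Sum.inl i)))) ⊗ₜ[ℝ]
              (β fun i => v (finSumFinEquiv (s (Sum.inr i))))))
        simp only [Units.smul_def, map_zsmul, LinearMap.mul'_apply]
        have h : Continuous fun v : Fin (k + l) → V =>
            (α fun i => v (finSumFinEquiv (s (Sum.inl i)))) *
              (β fun i => v (finSumFinEquiv (s (Sum.inr i)))) :=
          (α.cont.comp (continuous_pi fun i => continuous_apply _)).mul
            (β.cont.comp (continuous_pi fun i => continuous_apply _))
        exact h.const_smul ((Equiv.Perm.sign s : ℤˣ) : ℤ) }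

/-- The form `(w₁, …, w_l) ↦ η(w₁, …, w_l, u₁, …, u_k)`. -/
def fixLast {V : Type*} [AddCommGroup V] [Module ℝ V] [TopologicalSpace V] {k l : ℕ}
    (η : V [⋀^Fin (l + k)]→L[ℝ] ℝ) (u : Fin k → V) : V [⋀^Fin l]→L[ℝ] ℝ where
  toFun w := η (Fin.append w u)
  map_update_add' {inst} w i x y := by
    have h : ∀ z, Fin.append (@Function.update _ _ inst w i z) u
        = Function.update (Fin.append w u) (Fin.castAdd k i) z := by
      intro z
      have : inst = instDecidableEqFin l := Subsingleton.elim _ _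
      subst this
      ext j
      refine Fin.addCases (fun j => ?_) (fun j => ?_) j
      · by_cases hj : j = i
        · subst hj; simp
        · have : Fin.castAdd k j ≠ Fin.castAdd k i := by
            intro h; exact hj (Fin.castAdd_injective _ _ h)
          simp [Function.update_of_ne hj, Function.update_of_ne this]
      · have : Fin.natAdd l j ≠ Fin.castAdd k i := by
          intro h
          have := congrArg Fin.val h
          have hi := i.isLt
          simp at this
          omega
        simp [Function.update_of_ne this]
    simp only [h, η.map_update_add]
  map_update_smul' {inst} w i c x := by
    have h : ∀ z, Fin.append (@Function.update _ _ inst w i z) u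
        = Function.update (Fin.append w u) (Fin.castAdd k i) z := by
      intro z
      have : inst = instDecidableEqFin l := Subsingleton.elim _ _
      subst this
      ext j
      refine Fin.addCases (fun j => ?_) (fun j => ?_) j
      · by_cases hj : j = i
        · subst hj; simp
        · have : Fin.castAdd k j ≠ Fin.castAdd k i := by
            intro h; exact hj (Fin.castAdd_injective _ _ h)
          simp [Function.update_of_ne hj, Function.update_of_ne this]
      · have : Fin.natAdd l j ≠ Fin.castAdd k i := by
          intro h
          have := congrArg Fin.val h
          have hi := i.isLt
          simp at this
          omega
        simp [Function.update_of_ne this]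
    simp only [h, η.map_update_smul]
  map_eq_zero_of_eq' w i j hw hij := by
    refine η.map_eq_zero_of_eq _ (i := Fin.castAdd k i) (j := Fin.castAdd k j) ?_ ?_
    · simpa using hw
    · intro h; exact hij (Fin.castAdd_injective _ _ h)
  cont := by
    refine η.cont.comp (continuous_pi fun j => ?_)
    refine Fin.addCases (fun j => ?_) (fun j => ?_) j
    · simpa using continuous_apply j
    · simpa using continuous_const

end Algebra

/-! ### Constant forms on Euclidean space -/

/-- The form `e^{i₁} ∧ ⋯ ∧ e^{i_k}` on `ℝⁿ`, with `(eⁱ)` dual to the standard basis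
(indices start at `0`). -/
def dx {n k : ℕ} (i : Fin k → Fin n) :
    EuclideanSpace ℝ (Fin n) [⋀^Fin k]→L[ℝ] ℝ :=
  covectorWedge fun b => EuclideanSpace.proj (i b)

/-- The standard volume form `e¹ ∧ ⋯ ∧ eⁿ` on `ℝⁿ`. -/
def vol (n : ℕ) : EuclideanSpace ℝ (Fin n) [⋀^Fin n]→L[ℝ] ℝ := dx id

/-- The Hodge star on `ℝⁿ`, `n = l + k`, for the standard inner product and volume form, normalised
by `⋆α ∧ β = ⟨α, β⟩ vol`.  Taking for `β` the basis forms `e^I`, `I = {i₁ < ⋯ < i_k}`, this is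
`⋆α = ∑_I α(e_I) vol(·, …, ·, e_{i₁}, …, e_{i_k})`. -/
def hodgeStar {k l : ℕ} (α : EuclideanSpace ℝ (Fin (l + k)) [⋀^Fin k]→L[ℝ] ℝ) :
    EuclideanSpace ℝ (Fin (l + k)) [⋀^Fin l]→L[ℝ] ℝ :=
  ∑ I : Fin k ↪o Fin (l + k),
    α (fun a => EuclideanSpace.single (I a) 1) •
      fixLast (vol (l + k)) (fun a => EuclideanSpace.single (I a) 1)

/-! ### Differential forms on manifolds modelled on `ℝⁿ` -/

section Manifold

/-- A (not necessarily smooth) differential `k`-form on an `n`-manifold. -/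
abbrev Form (n : ℕ) (M : Type*) [TopologicalSpace M] [ChartedSpace (EuclideanSpace ℝ (Fin n)) M]
    (k : ℕ) : Type _ :=
  ∀ p : M, TangentSpace (𝓡 n) p [⋀^Fin k]→L[ℝ] ℝ

variable {n : ℕ} {M : Type*} [TopologicalSpace M] [ChartedSpace (EuclideanSpace ℝ (Fin n)) M]

/-- The differential at `y` of the inverse of the chart `e`. -/
def chartInvDeriv (e : OpenPartialHomeomorph M (EuclideanSpace ℝ (Fin n)))
    (y : EuclideanSpace ℝ (Fin n)) :
    EuclideanSpace ℝ (Fin n) →L[ℝ] TangentSpace (𝓡 n) (e.symm y) :=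
  mfderiv (𝓡 n) (𝓡 n) e.symm y

/-- The differential at `p` of the chart `e`. -/
def chartDeriv (e : OpenPartialHomeomorph M (EuclideanSpace ℝ (Fin n))) (p : M) :
    TangentSpace (𝓡 n) p →L[ℝ] EuclideanSpace ℝ (Fin n) :=
  mfderiv (𝓡 n) (𝓡 n) e p

/-- The expression `(e⁻¹)^* η` of a form in a chart `e`, a form on `e.target ⊆ ℝⁿ`. -/
def inChart {k : ℕ} (η : Form n M k)
    (e : OpenPartialHomeomorph M (EuclideanSpace ℝ (Fin n))) (y : EuclideanSpace ℝ (Fin n)) :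
    EuclideanSpace ℝ (Fin n) [⋀^Fin k]→L[ℝ] ℝ :=
  (η (e.symm y)).compContinuousLinearMap (chartInvDeriv e y)

/-- A form is smooth if all its chart expressions are. -/
def IsSmoothForm {k : ℕ} (η : Form n M k) : Prop :=
  ∀ e ∈ IsManifold.maximalAtlas (𝓡 n) ∞ M, ContDiffOn ℝ ∞ (inChart η e) e.target

/-- The exterior derivative of a form on a manifold: `dη` at `p` is `e^* d((e⁻¹)^* η)` at `p`, with
`e` the preferred chart at `p` (for smooth `η` every chart gives the same result). -/
def extD {k : ℕ} (η : Form n M k) : Form n M (k + 1) := fun p =>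
  (extDeriv (inChart η (chartAt (EuclideanSpace ℝ (Fin n)) p))
    (chartAt (EuclideanSpace ℝ (Fin n)) p p)).compContinuousLinearMap
      (chartDeriv (chartAt (EuclideanSpace ℝ (Fin n)) p) p)

variable (n M) in
/-- A field of bilinear forms on the tangent spaces. -/
abbrev BilinField : Type _ :=
  ∀ p : M, TangentSpace (𝓡 n) p →L[ℝ] TangentSpace (𝓡 n) p →L[ℝ] ℝ

variable (n M) in
/-- A field of endomorphisms of the tangent spaces. -/
abbrev EndField : Type _ :=
  ∀ p : M, TangentSpace (𝓡 n) p →L[ℝ] TangentSpace (𝓡 n) p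

/-- `g` is a smooth Riemannian metric. -/
structure IsRiemannian (g : BilinField n M) : Prop where
  symm : ∀ p v w, g p v w = g p w v
  pos : ∀ p v, v ≠ 0 → 0 < g p v v
  smooth : ∀ e ∈ IsManifold.maximalAtlas (𝓡 n) ∞ M, ∀ a b : EuclideanSpace ℝ (Fin n),
    ContDiffOn ℝ ∞ (fun y => g (e.symm y) (chartInvDeriv e y a) (chartInvDeriv e y b)) e.target

/-- `(g, J)` is an almost Hermitian structure: `g` is a Riemannian metric and `J` is a smooth almost
complex structure which is orthogonal for `g`. -/
structure IsAlmostHermitian (g : BilinField n M) (J : EndField n M) : Prop where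
  riemannian : IsRiemannian g
  smooth : ∀ e ∈ IsManifold.maximalAtlas (𝓡 n) ∞ M, ∀ a : EuclideanSpace ℝ (Fin n),
    ContDiffOn ℝ ∞ (fun y => chartDeriv e (e.symm y) (J (e.symm y) (chartInvDeriv e y a))) e.target
  sq : ∀ p v, J p (J p v) = -v
  orthogonal : ∀ p v w, g p (J p v) (J p w) = g p v w

/-- The vector field `X` is differentiable at `p`. -/
def IsDiffVectorFieldAt [IsManifold (𝓡 n) 2 M] (X : ∀ p : M, TangentSpace (𝓡 n) p) (p : M) : Prop :=
  MDifferentiableAt (𝓡 n) (𝓡 n).tangent (fun q => (⟨q, X q⟩ : TangentBundle (𝓡 n) M)) p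

/-- The connection `∇` on the tangent bundle is the Levi-Civita connection of `g`: it is
torsion-free and metric.  (`cov X p v` is `∇_v X` at `p`.) -/
structure IsLeviCivita [IsManifold (𝓡 n) 2 M] (g : BilinField n M)
    (cov : CovariantDerivative (𝓡 n) (EuclideanSpace ℝ (Fin n))
      (TangentSpace (𝓡 n) : M → Type _)) : Prop where
  torsion_free : cov.torsion = 0
  metric : ∀ (X Y : ∀ p : M, TangentSpace (𝓡 n) p) (p : M),
    IsDiffVectorFieldAt X p → IsDiffVectorFieldAt Y p → ∀ v : TangentSpace (𝓡 n) p,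
      mvfderiv (𝓡 n) (fun q => g q (X q) (Y q)) p v
        = g p (cov X p v) (Y p) + g p (X p) (cov Y p v)

/-- The almost Hermitian structure `(g, J)` is nearly Kähler: `(∇_X J) X = 0` for all vector fields
`X`, where `∇` is the Levi-Civita connection and `(∇_X J) Y = ∇_X (J Y) - J (∇_X Y)`.  (The
conditions in `IsLeviCivita` determine `∇_v X` for every differentiable `X`, so that the existential
quantifier just names the Levi-Civita connection.) -/
structure IsNearlyKahler [IsManifold (𝓡 n) 2 M] (g : BilinField n M) (J : EndField n M) :
    Prop where
  almostHermitian : IsAlmostHermitian g J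
  skew : ∃ cov : CovariantDerivative (𝓡 n) (EuclideanSpace ℝ (Fin n))
      (TangentSpace (𝓡 n) : M → Type _), IsLeviCivita g cov ∧
    ∀ (X : ∀ p : M, TangentSpace (𝓡 n) p) (p : M), IsDiffVectorFieldAt X p →
      cov (fun q => J q (X q)) p (X p) - J p (cov X p (X p)) = 0

/-- `(σ, ψ₊, ψ₋)` is an `SU(3)`-structure on a six-manifold, with underlying almost Hermitian
structure `(g, J)`: the forms are smooth, and at every point there is an orthonormal basis
`e₁, Je₁, e₂, Je₂, e₃, Je₃` of the tangent space such that, in terms of the dual basis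
`a₁, b₁, a₂, b₂, a₃, b₃`,
`σ = a₁ ∧ b₁ + a₂ ∧ b₂ + a₃ ∧ b₃` and
`ψ₊ + i ψ₋ = (a₁ + i b₁) ∧ (a₂ + i b₂) ∧ (a₃ + i b₃)`. -/
structure IsSU3Structure {M : Type*} [TopologicalSpace M]
    [ChartedSpace (EuclideanSpace ℝ (Fin 6)) M] (g : BilinField 6 M) (J : EndField 6 M)
    (σ : Form 6 M 2) (ψp ψm : Form 6 M 3) : Prop where
  almostHermitian : IsAlmostHermitian g J
  fundamental : ∀ p v w, σ p ![v, w] = g p (J p v) w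
  smooth_fundamental : IsSmoothForm σ
  smooth_re : IsSmoothForm ψp
  smooth_im : IsSmoothForm ψm
  adapted : ∀ p : M, ∃ e : Fin 3 → TangentSpace (𝓡 6) p,
    (∀ i j, g p (e i) (e j) = if i = j then 1 else 0) ∧
    (∀ i j, g p (J p (e i)) (J p (e j)) = if i = j then 1 else 0) ∧
    (∀ i j, g p (e i) (J p (e j)) = 0) ∧
    ∃ a b : Fin 3 → TangentSpace (𝓡 6) p →L[ℝ] ℝ,
      (∀ i, a i = g p (e i)) ∧ (∀ i, b i = g p (J p (e i))) ∧
      σ p = covectorWedge ![a 0, b 0] + covectorWedge ![a 1, b 1] + covectorWedge ![a 2, b 2] ∧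
      ψp p = covectorWedge ![a 0, a 1, a 2] - covectorWedge ![b 0, b 1, a 2]
        - covectorWedge ![a 0, b 1, b 2] - covectorWedge ![b 0, a 1, b 2] ∧
      ψm p = covectorWedge ![a 0, a 1, b 2] - covectorWedge ![b 0, b 1, b 2]
        + covectorWedge ![a 0, b 1, a 2] + covectorWedge ![b 0, a 1, a 2]

end Manifold

/-! ### The six-sphere in the imaginary octonions -/

/-- `ℝ⁷ = Im 𝕆`. -/
abbrev E7 : Type := EuclideanSpace ℝ (Fin 7)

/-- The unit sphere `S⁶ ⊆ ℝ⁷`. -/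
abbrev S6 : Type := Metric.sphere (0 : E7) 1

/-- `φ = e¹²³ + e¹⁴⁵ + e¹⁶⁷ + e²⁴⁶ - e²⁵⁷ - e³⁴⁷ - e³⁵⁶` (with indices shifted to start at `0`). -/
def phi : E7 [⋀^Fin 3]→L[ℝ] ℝ :=
  dx ![0, 1, 2] + dx ![0, 3, 4] + dx ![0, 5, 6] + dx ![1, 3, 5]
    - dx ![1, 4, 6] - dx ![2, 3, 6] - dx ![2, 4, 5]

/-- The four-form `⋆φ` on `ℝ⁷`. -/
def starPhi : E7 [⋀^Fin 4]→L[ℝ] ℝ := hodgeStar (k := 3) (l := 4) phi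

theorem update_one (u v z y : E7) : Function.update ![u, v, z] 1 y = ![u, y, z] := by
  ext i : 1
  fin_cases i <;> rfl

theorem update_two (u v z y : E7) : Function.update ![u, v, z] 2 y = ![u, v, y] := by
  ext i : 1
  fin_cases i <;> rfl

/-- The cross product `u × v`, as a linear map in `v`; see `inner_cross`. -/
def cross (u : E7) : E7 →L[ℝ] E7 :=
  LinearMap.toContinuousLinearMap
    { toFun := fun v => WithLp.toLp 2 fun i => phi ![u, v, EuclideanSpace.single i 1]
      map_add' := fun v w => by
        ext i
        have h := phi.map_update_add ![u, 0, EuclideanSpace.single i 1] 1 v w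
        simp only [update_one] at h
        exact h
      map_smul' := fun c v => by
        ext i
        have h := phi.map_update_smul ![u, 0, EuclideanSpace.single i 1] 1 c v
        simp only [update_one] at h
        exact h }

/-- The defining property of the cross product: `⟨u × v, z⟩ = φ(u, v, z)`. -/
theorem inner_cross (u v z : E7) : inner ℝ (cross u v) z = phi ![u, v, z] := by
  have hz : z = ∑ i, z i • (EuclideanSpace.single i (1 : ℝ) : E7) := by
    ext j
    simp [Finset.sum_apply, Pi.single_apply]
  let L : E7 →ₗ[ℝ] ℝ :=
    { toFun := fun y => phi ![u, v, y]
      map_add' := fun x y => by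
        have h := phi.map_update_add ![u, v, 0] 2 x y
        simp only [update_two] at h
        exact h
      map_smul' := fun c x => by
        have h := phi.map_update_smul ![u, v, 0] 2 c x
        simp only [update_two] at h
        exact h }
  change _ = L z
  conv_rhs => rw [hz]
  rw [map_sum]
  simp only [map_smul]
  simp [PiLp.inner_apply, cross, L]

/-- The differential of the inclusion `ι : S⁶ → ℝ⁷`. -/
def dIota (p : S6) : TangentSpace (𝓡 6) p →L[ℝ] E7 :=
  mvfderiv (𝓡 6) (Subtype.val : S6 → E7) p

theorem dIota_injective (p : S6) : Function.Injective (dIota p) :=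
  haveI : Fact (Module.finrank ℝ E7 = 6 + 1) := ⟨finrank_euclideanSpace_fin⟩
  injective_mvfderiv_subtypeVal_sphere p

theorem range_dIota (p : S6) : (dIota p).range = (Submodule.span ℝ {(p : E7)})ᗮ :=
  haveI : Fact (Module.finrank ℝ E7 = 6 + 1) := ⟨finrank_euclideanSpace_fin⟩
  range_mvfderiv_subtypeVal p

/-- The unit normal vector field of `S⁶`. -/
def normal (p : S6) : E7 := p

theorem cross_mem_range (p : S6) (x : E7) : cross (normal p) x ∈ (dIota p).range := by
  rw [range_dIota, Submodule.mem_orthogonal_singleton_iff_inner_left, inner_cross]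
  exact phi.map_eq_zero_of_eq _ (i := 0) (j := 2) (by simp [normal]) (by decide)

/-- The almost complex structure of `S⁶`, `J X = N × X`; see `dIota_J`. -/
def J (p : S6) : TangentSpace (𝓡 6) p →L[ℝ] TangentSpace (𝓡 6) p :=
  haveI : FiniteDimensional ℝ (TangentSpace (𝓡 6) p) :=
    inferInstanceAs (FiniteDimensional ℝ (EuclideanSpace ℝ (Fin 6)))
  haveI : T2Space (TangentSpace (𝓡 6) p) :=
    inferInstanceAs (T2Space (EuclideanSpace ℝ (Fin 6)))
  LinearMap.toContinuousLinearMap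
    ((LinearEquiv.ofInjective (dIota p : TangentSpace (𝓡 6) p →ₗ[ℝ] E7)
        (dIota_injective p)).symm.toLinearMap ∘ₗ
      LinearMap.codRestrict _
        ((cross (normal p) : E7 →ₗ[ℝ] E7) ∘ₗ (dIota p : TangentSpace (𝓡 6) p →ₗ[ℝ] E7))
        (fun v => cross_mem_range p (dIota p v)))

theorem dIota_J (p : S6) (v : TangentSpace (𝓡 6) p) :
    dIota p (J p v) = cross (normal p) (dIota p v) := by
  have h := LinearEquiv.apply_symm_apply
    (LinearEquiv.ofInjective (dIota p : TangentSpace (𝓡 6) p →ₗ[ℝ] E7) (dIota_injective p))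
    ⟨cross (normal p) (dIota p v), cross_mem_range p (dIota p v)⟩
  exact congrArg Subtype.val h

/-- The metric of `S⁶` induced by the inclusion in `ℝ⁷`. -/
def g (p : S6) : TangentSpace (𝓡 6) p →L[ℝ] TangentSpace (𝓡 6) p →L[ℝ] ℝ :=
  ContinuousLinearMap.precomp ℝ (dIota p) ∘L (innerSL ℝ : E7 →L[ℝ] E7 →L[ℝ] ℝ) ∘L dIota p

theorem g_apply (p : S6) (v w : TangentSpace (𝓡 6) p) :
    g p v w = inner ℝ (dIota p v) (dIota p w) := rfl

theorem g_J_self (p : S6) (v : TangentSpace (𝓡 6) p) : g p (J p v) v = 0 := by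
  change inner ℝ (dIota p (J p v)) (dIota p v) = 0
  rw [dIota_J, inner_cross]
  exact phi.map_eq_zero_of_eq _ (i := 1) (j := 2) (by simp) (by decide)

/-- The fundamental two-form `σ = g(J·, ·)` of `S⁶`. -/
def sigma : Form 6 S6 2 := fun p =>
  { toFun := fun v => g p (J p (v 0)) (v 1)
    map_update_add' := fun {inst} v i x y => by
      have : inst = instDecidableEqFin 2 := Subsingleton.elim _ _
      subst this
      fin_cases i <;> simp
    map_update_smul' := fun {inst} v i c x => by
      have : inst = instDecidableEqFin 2 := Subsingleton.elim _ _
      subst this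
      fin_cases i <;> simp
    map_eq_zero_of_eq' := fun v i j hv hij => by
      have h : v 0 = v 1 := by
        fin_cases i <;> fin_cases j <;> first | exact absurd rfl hij | exact hv | exact hv.symm
      change g p (J p (v 0)) (v 1) = 0
      rw [h]
      exact g_J_self p (v 1)
    cont := by
      change Continuous fun v : Fin 2 → TangentSpace (𝓡 6) p =>
        inner ℝ (dIota p (J p (v 0))) (dIota p (v 1))
      exact ((dIota p).continuous.comp ((J p).continuous.comp (continuous_apply 0))).inner
        ((dIota p).continuous.comp (continuous_apply 1)) }

/-- `ψ₊ = ι^* φ`. -/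
def psiPlus : Form 6 S6 3 := fun p => phi.compContinuousLinearMap (dIota p)

/-- `ψ₋ = -ι^* (N ⌟ ⋆φ)`. -/
def psiMinus : Form 6 S6 3 := fun p =>
  -(starPhi.curryLeft (normal p)).compContinuousLinearMap (dIota p)

end NearlyKahlerSphere

end

open scoped Manifold ContDiff TensorProduct

noncomputable section

namespace NearlyKahlerSphere

/-! The unit normal of the sphere is the position vector. In a chart with inverse F, viewed as a map
into ℝ⁷, σ and ψ₋ are therefore the pull-backs under F of x ⌟ φ and -(x ⌟ ⋆φ), which are linear in
x. For a constant k-form η one has d(x ⌟ η) = k η (`extDeriv_curryLeft`), and d commutes with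
pull-back, so dσ = 3 ι^*φ and dψ₋ = -4 ι^*⋆φ (`extD_eq_of_inChart`). The second equation then needs
only the pointwise identity ⋆φ = σ ∧ σ / 2 on p^⊥ (`IsAdapted.starPhi_eq`).

The pointwise algebra rests on a few identities for the cross product, verified in coordinates. For
a unit vector p they show that J = p × is an orthogonal complex structure on p^⊥ and that J may be
moved between the arguments of φ there; hence φ restricts to the real part of a complex volume form.
A unitary frame x, y, x × y with y orthogonal to p, x and Jx makes this explicit
(`exists_isAdapted`, `IsAdapted.phi_eq`).

The Levi-Civita connection is the tangential part of the derivative D of ℝ⁷. Since N has the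
identity as derivative, D_X (N × X) = X × X + N × D_X X = N × D_X X, whose tangential part is J ∇_X
X. -/

/-! ### Coordinate formulas for forms and for the cross product. -/

theorem covectorWedge_apply {V : Type*} [AddCommGroup V] [Module ℝ V] [TopologicalSpace V] {k : ℕ}
    (θ : Fin k → V →L[ℝ] ℝ) (v : Fin k → V) :
    covectorWedge θ v = Matrix.det (Matrix.of fun a b => θ b (v a)) := rfl

theorem covectorWedge_two_apply {V : Type*} [AddCommGroup V] [Module ℝ V] [TopologicalSpace V]
    (α β : V →L[ℝ] ℝ) (v : Fin 2 → V) :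
    covectorWedge ![α, β] v = α (v 0) * β (v 1) - β (v 0) * α (v 1) := by
  rw [covectorWedge_apply, Matrix.det_fin_two]
  simp

theorem covectorWedge_three_apply {V : Type*} [AddCommGroup V] [Module ℝ V] [TopologicalSpace V]
    (α β γ : V →L[ℝ] ℝ) (v : Fin 3 → V) :
    covectorWedge ![α, β, γ] v =
      α (v 0) * β (v 1) * γ (v 2) - α (v 0) * γ (v 1) * β (v 2) - β (v 0) * α (v 1) * γ (v 2)
        + β (v 0) * γ (v 1) * α (v 2) + γ (v 0) * α (v 1) * β (v 2)
        - γ (v 0) * β (v 1) * α (v 2) := by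
  rw [covectorWedge_apply, Matrix.det_fin_three]
  simp

theorem dx_three_apply {n : ℕ} (i j k : Fin n) (u v w : EuclideanSpace ℝ (Fin n)) :
    dx ![i, j, k] ![u, v, w] =
      u i * v j * w k - u i * v k * w j - u j * v i * w k
        + u j * v k * w i + u k * v i * w j - u k * v j * w i := by
  rw [dx, covectorWedge_apply, Matrix.det_fin_three]
  simp

theorem phi_apply (u v w : E7) :
    phi ![u, v, w] = dx ![0, 1, 2] ![u, v, w] + dx ![0, 3, 4] ![u, v, w]
      + dx ![0, 5, 6] ![u, v, w] + dx ![1, 3, 5] ![u, v, w] - dx ![1, 4, 6] ![u, v, w]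
      - dx ![2, 3, 6] ![u, v, w] - dx ![2, 4, 5] ![u, v, w] := rfl

theorem cross_apply (u v : E7) (i : Fin 7) :
    cross u v i = phi ![u, v, EuclideanSpace.single i 1] := rfl

theorem cross_eq (u v : E7) :
    cross u v = !₂[u 1 * v 2 - u 2 * v 1 + u 3 * v 4 - u 4 * v 3 + u 5 * v 6 - u 6 * v 5,
      u 2 * v 0 - u 0 * v 2 + u 3 * v 5 - u 5 * v 3 - u 4 * v 6 + u 6 * v 4,
      u 0 * v 1 - u 1 * v 0 - u 3 * v 6 + u 6 * v 3 - u 4 * v 5 + u 5 * v 4,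
      u 4 * v 0 - u 0 * v 4 + u 5 * v 1 - u 1 * v 5 + u 2 * v 6 - u 6 * v 2,
      u 0 * v 3 - u 3 * v 0 + u 1 * v 6 - u 6 * v 1 + u 2 * v 5 - u 5 * v 2,
      u 6 * v 0 - u 0 * v 6 + u 1 * v 3 - u 3 * v 1 - u 2 * v 4 + u 4 * v 2,
      u 0 * v 5 - u 5 * v 0 - u 1 * v 4 + u 4 * v 1 - u 2 * v 3 + u 3 * v 2] := by
  ext i
  rw [cross_apply, phi_apply]
  simp only [dx_three_apply]
  fin_cases i <;> simp <;> ring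

theorem inner_eq_sum (u v : E7) :
    inner ℝ u v = u 0 * v 0 + u 1 * v 1 + u 2 * v 2 + u 3 * v 3 + u 4 * v 4 + u 5 * v 5
      + u 6 * v 6 := by
  simp [PiLp.inner_apply, Fin.sum_univ_succ]
  ring

/-- A polynomial identity in coordinates. It yields J² = -1 and, by skewness of u ×, the inner
products ⟨u × v, u × w⟩. -/
theorem cross_cross (u v : E7) :
    cross u (cross u v) = (inner ℝ u v : ℝ) • u - (inner ℝ u u : ℝ) • v := by
  simp only [inner_eq_sum]
  rw [cross_eq u (cross u v), cross_eq u v]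
  ext i
  fin_cases i <;> simp <;> ring

theorem cross_self (u : E7) : cross u u = 0 := by
  rw [cross_eq]
  ext i
  fin_cases i <;> simp <;> ring

theorem cross_swap (u v : E7) : cross u v = -cross v u := by
  rw [cross_eq, cross_eq]
  ext i
  fin_cases i <;> simp <;> ring

theorem inner_cross_left (u v w : E7) : inner ℝ (cross u v) w = -inner ℝ v (cross u w) := by
  simp only [inner_eq_sum, cross_eq]
  simp
  ring

/-! ### The four-form ⋆φ. -/

/-- Permuting the columns of the determinant by π puts the fixed basis vectors in an identity block
with zeros to its left, so only the upper left minor remains, up to the sign of π. -/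
theorem fixLast_vol_perm {k l : ℕ} (π : Equiv.Perm (Fin (l + k)))
    (v : Fin l → EuclideanSpace ℝ (Fin (l + k))) :
    fixLast (vol (l + k)) (fun a => EuclideanSpace.single (π (Fin.natAdd l a)) 1) v
      = (Equiv.Perm.sign π : ℤ) * dx (fun b => π (Fin.castAdd k b)) v := by
  change Matrix.det (Matrix.of fun a b => (Fin.append v
    (fun a => EuclideanSpace.single (π (Fin.natAdd l a)) (1 : ℝ)) a : EuclideanSpace ℝ _) b)
      = _ * Matrix.det (Matrix.of fun a b => v a (π (Fin.castAdd k b)))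
  set M : Matrix (Fin (l + k)) (Fin (l + k)) ℝ := Matrix.of fun a b => (Fin.append v
    (fun a => EuclideanSpace.single (π (Fin.natAdd l a)) (1 : ℝ)) a : EuclideanSpace ℝ _) b
  have h1 := Matrix.det_permute' π M
  have h2 : ((Equiv.Perm.sign π : ℤ) : ℝ) * (Equiv.Perm.sign π : ℤ) = 1 := by
    exact_mod_cast Int.units_coe_mul_self (Equiv.Perm.sign π)
  have h3 : (M.submatrix id π).det =
      Matrix.det (Matrix.of fun a b => v a (π (Fin.castAdd k b))) := by
    rw [← Matrix.det_submatrix_equiv_self finSumFinEquiv]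
    have : ((M.submatrix id π).submatrix finSumFinEquiv finSumFinEquiv) =
        Matrix.fromBlocks (Matrix.of fun a b => v a (π (Fin.castAdd k b)))
          (Matrix.of fun a b => v a (π (Fin.natAdd l b))) 0 1 := by
      ext (a | a) (b | b)
      · simp [M]
      · simp [M]
      · have : Fin.natAdd l a ≠ Fin.castAdd k b := by
          simp only [ne_eq, Fin.ext_iff, Fin.val_natAdd, Fin.val_castAdd]; omega
        simp [M, this.symm]
      · simp [M, Matrix.one_apply, eq_comm]
    rw [this, Matrix.det_fromBlocks_zero₂₁, Matrix.det_one, mul_one]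
  rw [← h3, h1, ← mul_assoc, h2, one_mul]

/-- The triples of indices of the terms of `φ`. -/
def phiTriples : Finset (Fin 3 → Fin 7) :=
  {![0, 1, 2], ![0, 3, 4], ![0, 5, 6], ![1, 3, 5], ![1, 4, 6], ![2, 3, 6], ![2, 4, 5]}

/-- The value of `e^{jkl}` on `(e_a, e_b, e_c)`. -/
def basisSign (j k l a b c : Fin 7) : ℤ :=
  let δ : Fin 7 → Fin 7 → ℤ := fun x y => if y = x then 1 else 0
  δ a j * δ b k * δ c l - δ a j * δ b l * δ c k - δ a k * δ b j * δ c l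
        + δ a k * δ b l * δ c j + δ a l * δ b j * δ c k - δ a l * δ b k * δ c j

theorem dx_single (j k l a b c : Fin 7) :
    dx ![j, k, l] ![(EuclideanSpace.single a 1 : E7), EuclideanSpace.single b 1,
      EuclideanSpace.single c 1] = basisSign j k l a b c := by
  rw [dx_three_apply]
  simp [basisSign]

/-- The value of `φ` on a triple of basis vectors. -/
def phiSign (a b c : Fin 7) : ℤ :=
  basisSign 0 1 2 a b c + basisSign 0 3 4 a b c + basisSign 0 5 6 a b c + basisSign 1 3 5 a b c
    - basisSign 1 4 6 a b c - basisSign 2 3 6 a b c - basisSign 2 4 5 a b c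

theorem phi_single (i : Fin 3 → Fin 7) :
    phi (fun a => EuclideanSpace.single (i a) 1) = phiSign (i 0) (i 1) (i 2) := by
  have : (fun a => EuclideanSpace.single (i a) 1 : Fin 3 → E7) =
      ![EuclideanSpace.single (i 0) 1, EuclideanSpace.single (i 1) 1,
        EuclideanSpace.single (i 2) 1] := by
    ext a : 1
    fin_cases a <;> rfl
  rw [this, phi_apply]
  simp only [dx_single]
  simp [phiSign]

/-- The values of φ on basis vectors are integers, so this is a finite check; it cuts the 35 terms
of the Hodge star down to seven. -/
theorem phiSign_eq_zero : ∀ a b c : Fin 7, a < b → b < c → ![a, b, c] ∉ phiTriples →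
    phiSign a b c = 0 := by
  decide +kernel

theorem sum_orderEmb_phi (f : (Fin 3 → Fin 7) → ℝ) :
    ∑ I : Fin 3 ↪o Fin 7, phi (fun a => EuclideanSpace.single (I a) 1) * f I
      = ∑ i ∈ phiTriples, phiSign (i 0) (i 1) (i 2) * f i := by
  classical
  have h1 : ∑ I : Fin 3 ↪o Fin 7, phi (fun a => EuclideanSpace.single (I a) 1) * f I
      = ∑ i : Fin 3 → Fin 7 with StrictMono i, phiSign (i 0) (i 1) (i 2) * f i := by
    refine Finset.sum_bij (fun I _ => I) (fun I _ => by simpa using I.strictMono)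
      (fun I _ I' _ h => DFunLike.coe_injective h) (fun i hi => ?_) (fun I _ => ?_)
    · exact ⟨OrderEmbedding.ofStrictMono i (by simpa using hi), by simp, rfl⟩
    · rw [phi_single]
  rw [h1]
  symm
  refine Finset.sum_subset (fun i hi => ?_) (fun i hi hi' => ?_)
  · have : ∀ i ∈ phiTriples, StrictMono i := by
      simp only [Fin.strictMono_iff_lt_succ]
      decide +kernel
    simpa using this i hi
  · have hm : StrictMono i := by simpa using hi
    have he : i = ![i 0, i 1, i 2] := by
      ext a : 1
      fin_cases a <;> rfl
    rw [phiSign_eq_zero _ _ _ (hm (by decide)) (hm (by decide)) (he ▸ hi')]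
    simp

/-- The permutation with the given values and inverse. -/
abbrev permOf (f g : Fin 7 → Fin 7) (h : ∀ i, g (f i) = i) (h' : ∀ i, f (g i) = i) :
    Equiv.Perm (Fin 7) := ⟨f, g, h, h'⟩

theorem fixLast_vol_eq (j : Fin 4 → Fin 7) (i : Fin 3 → Fin 7) (π : Equiv.Perm (Fin 7))
    (hi : ∀ a, π (Fin.natAdd 4 a) = i a) (hj : ∀ a, π (Fin.castAdd 3 a) = j a)
    (h : Equiv.Perm.sign π = 1) (v : Fin 4 → E7) :
    fixLast (l := 4) (vol (4 + 3)) (fun a => EuclideanSpace.single (i a) 1) v = dx j v := by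
  have := fixLast_vol_perm (k := 3) (l := 4) π v
  simp only [hi, hj, h] at this
  simpa using this

theorem phiSign_triples : ∀ i ∈ phiTriples, phiSign (i 0) (i 1) (i 2) =
    if i = ![1, 4, 6] ∨ i = ![2, 3, 6] ∨ i = ![2, 4, 5] then -1 else 1 := by
  decide +kernel

theorem starPhi_eq_sum_orderEmb (v : Fin 4 → E7) : starPhi v =
    ∑ I : Fin 3 ↪o Fin 7, phi (fun a => EuclideanSpace.single (I a) 1) *
      fixLast (l := 4) (vol (4 + 3)) (fun a => EuclideanSpace.single (I a) 1) v := by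
  simp only [starPhi, hodgeStar, ContinuousAlternatingMap.sum_apply,
    ContinuousAlternatingMap.smul_apply, smul_eq_mul]

theorem starPhi_eq_sum (v : Fin 4 → E7) : starPhi v =
    ∑ i ∈ phiTriples, phiSign (i 0) (i 1) (i 2) *
      fixLast (l := 4) (vol (4 + 3)) (fun a => EuclideanSpace.single (i a) 1) v :=
  (starPhi_eq_sum_orderEmb v).trans (sum_orderEmb_phi fun i =>
    fixLast (l := 4) (vol (4 + 3)) (fun a => EuclideanSpace.single (i a) 1) v)

theorem sum_phiTriples (f : (Fin 3 → Fin 7) → ℝ) :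
    ∑ i ∈ phiTriples, phiSign (i 0) (i 1) (i 2) * f i =
      f ![0, 1, 2] + f ![0, 3, 4] + f ![0, 5, 6] + f ![1, 3, 5] - f ![1, 4, 6] - f ![2, 3, 6]
        - f ![2, 4, 5] := by
  have s := phiSign_triples
  rw [phiTriples, Finset.sum_insert (by decide), Finset.sum_insert (by decide),
    Finset.sum_insert (by decide), Finset.sum_insert (by decide),
    Finset.sum_insert (by decide), Finset.sum_insert (by decide), Finset.sum_singleton]
  rw [s ![0, 1, 2] (by decide), s ![0, 3, 4] (by decide), s ![0, 5, 6] (by decide),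
    s ![1, 3, 5] (by decide), s ![1, 4, 6] (by decide), s ![2, 3, 6] (by decide),
    s ![2, 4, 5] (by decide)]
  simp
  ring

theorem starPhi_eq (v : Fin 4 → E7) : starPhi v =
    dx ![3, 4, 5, 6] v + dx ![1, 2, 5, 6] v + dx ![1, 2, 3, 4] v + dx ![0, 2, 4, 6] v
      - dx ![0, 2, 3, 5] v - dx ![0, 1, 4, 5] v - dx ![0, 1, 3, 6] v := by
  -- Each permutation lists the complement of a triple and then the triple. All seven are even, so
  -- the only signs in ⋆φ are those of φ.
  have e1 := fixLast_vol_eq ![3, 4, 5, 6] ![0, 1, 2]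
    (permOf ![3, 4, 5, 6, 0, 1, 2] ![4, 5, 6, 0, 1, 2, 3] (by decide) (by decide))
    (by decide) (by decide) (by decide +kernel) v
  have e2 := fixLast_vol_eq ![1, 2, 5, 6] ![0, 3, 4]
    (permOf ![1, 2, 5, 6, 0, 3, 4] ![4, 0, 1, 5, 6, 2, 3] (by decide) (by decide))
    (by decide) (by decide) (by decide +kernel) v
  have e3 := fixLast_vol_eq ![1, 2, 3, 4] ![0, 5, 6]
    (permOf ![1, 2, 3, 4, 0, 5, 6] ![4, 0, 1, 2, 3, 5, 6] (by decide) (by decide))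
    (by decide) (by decide) (by decide +kernel) v
  have e4 := fixLast_vol_eq ![0, 2, 4, 6] ![1, 3, 5]
    (permOf ![0, 2, 4, 6, 1, 3, 5] ![0, 4, 1, 5, 2, 6, 3] (by decide) (by decide))
    (by decide) (by decide) (by decide +kernel) v
  have e5 := fixLast_vol_eq ![0, 2, 3, 5] ![1, 4, 6]
    (permOf ![0, 2, 3, 5, 1, 4, 6] ![0, 4, 1, 2, 5, 3, 6] (by decide) (by decide))
    (by decide) (by decide) (by decide +kernel) v
  have e6 := fixLast_vol_eq ![0, 1, 4, 5] ![2, 3, 6]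
    (permOf ![0, 1, 4, 5, 2, 3, 6] ![0, 1, 4, 5, 2, 3, 6] (by decide) (by decide))
    (by decide) (by decide) (by decide +kernel) v
  have e7 := fixLast_vol_eq ![0, 1, 3, 6] ![2, 4, 5]
    (permOf ![0, 1, 3, 6, 2, 4, 5] ![0, 1, 4, 2, 5, 6, 3] (by decide) (by decide))
    (by decide) (by decide) (by decide +kernel) v
  rw [starPhi_eq_sum, sum_phiTriples, e1, e2, e3, e4, e5, e6, e7]

theorem dx_four_apply {n : ℕ} (i j k l : Fin n) (u v w z : EuclideanSpace ℝ (Fin n)) :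
    dx ![i, j, k, l] ![u, v, w, z] = 
      u i * dx ![j, k, l] ![v, w, z] - u j * dx ![i, k, l] ![v, w, z]
        + u k * dx ![i, j, l] ![v, w, z] - u l * dx ![i, j, k] ![v, w, z] := by
  simp only [dx_three_apply]
  rw [dx, covectorWedge_apply, Matrix.det_succ_row_zero]
  simp [Fin.sum_univ_succ, Matrix.det_fin_three, Fin.succAbove]
  ring

/-- From here on ⋆φ enters only through the cross product. -/
theorem starPhi_eq_inner_cross (x y z w : E7) :
    starPhi ![x, y, z, w] = inner ℝ (cross x y) (cross z w)
      - inner ℝ x z * inner ℝ y w + inner ℝ x w * inner ℝ y z := by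
  rw [starPhi_eq]
  simp only [dx_four_apply, dx_three_apply, inner_eq_sum, cross_eq]
  simp
  ring

/-! ### Moving the complex structure p × between arguments. -/

theorem cross_add_left (u u' v : E7) : cross (u + u') v = cross u v + cross u' v := by
  rw [cross_swap, map_add, cross_swap u, cross_swap u', neg_add]

theorem cross_smul_left (c : ℝ) (u v : E7) : cross (c • u) v = c • cross u v := by
  rw [cross_swap, map_smul, cross_swap u, smul_neg]

theorem inner_cross_cross_same (x y z : E7) : (inner ℝ (cross x y) (cross x z) : ℝ) =
    inner ℝ x x * inner ℝ y z - inner ℝ x y * inner ℝ x z := by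
  rw [inner_cross_left, cross_cross, inner_sub_right, inner_smul_right, inner_smul_right,
    real_inner_comm x y]
  ring

/-- In view of `starPhi_eq_inner_cross`, this is the invariance of ⋆φ under cyclic permutation of
its first three arguments. -/
theorem inner_cross_cross (p u v w : E7) : (inner ℝ (cross p u) (cross v w) : ℝ) =
    inner ℝ (cross u v) (cross p w) + 2 * (inner ℝ p v * inner ℝ u w)
      - inner ℝ p w * inner ℝ u v - inner ℝ p u * inner ℝ v w := by
  simp only [inner_eq_sum, cross_eq]
  simp
  ring

theorem inner_cross_rotate (u v w : E7) :
    (inner ℝ (cross u v) w : ℝ) = inner ℝ (cross v w) u := by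
  simp only [inner_eq_sum, cross_eq]
  simp
  ring

theorem inner_cross_self_left (u v : E7) : (inner ℝ u (cross u v) : ℝ) = 0 := by
  rw [real_inner_comm, inner_cross_rotate, inner_cross_rotate, cross_self, inner_zero_left]

/-! ### Unitary frames adapted to a point of the sphere. -/

/-- `a₀, a₁, a₂` is a unitary basis of `p^⊥`, with complex structure `p ×`, such that
`a₀ × a₁ = a₂`. -/
structure IsAdapted (p : E7) (a : Fin 3 → E7) : Prop where
  norm : (inner ℝ p p : ℝ) = 1
  perp : ∀ i, (inner ℝ p (a i) : ℝ) = 0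
  orth : ∀ i j, (inner ℝ (a i) (a j) : ℝ) = if i = j then 1 else 0
  orthJ : ∀ i j, (inner ℝ (a i) (cross p (a j)) : ℝ) = 0
  cross_eq : cross (a 0) (a 1) = a 2

theorem exists_unit_orthogonal (f : Fin 3 → E7) :
    ∃ x : E7, (inner ℝ x x : ℝ) = 1 ∧ ∀ i, (inner ℝ (f i) x : ℝ) = 0 := by
  have h1 : Module.finrank ℝ (Submodule.span ℝ (Set.range f)) ≤ 3 := by
    simpa [Set.finrank] using finrank_range_le_card (R := ℝ) f
  have h2 := Submodule.finrank_add_finrank_orthogonal (Submodule.span ℝ (Set.range f))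
  rw [finrank_euclideanSpace_fin] at h2
  have h3 : 0 < Module.finrank ℝ (Submodule.span ℝ (Set.range f))ᗮ := by omega
  obtain ⟨⟨y, hy⟩, hy0⟩ := Module.finrank_pos_iff_exists_ne_zero.1 h3
  have hy0 : y ≠ 0 := fun h => hy0 (by simp [h])
  refine ⟨(‖y‖⁻¹ : ℝ) • y, ?_, fun i => ?_⟩
  · rw [real_inner_self_eq_norm_sq, norm_smul, norm_inv, norm_norm,
      inv_mul_cancel₀ (norm_ne_zero_iff.2 hy0), one_pow]
  · rw [inner_smul_right, (Submodule.mem_orthogonal _ _).1 hy _ (Submodule.subset_span ⟨i, rfl⟩),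
      mul_zero]

theorem exists_isAdapted (p : E7) (hp : (inner ℝ p p : ℝ) = 1) : ∃ a, IsAdapted p a := by
  -- Orthogonality to p is all that is needed; p is repeated to fill the three slots.
  obtain ⟨x, hx, hpx⟩ := exists_unit_orthogonal ![p, p, p]
  obtain ⟨y, hy, hpy⟩ := exists_unit_orthogonal ![p, x, cross p x]
  have px : (inner ℝ p x : ℝ) = 0 := hpx 0
  have py : (inner ℝ p y : ℝ) = 0 := hpy 0
  have xy : (inner ℝ x y : ℝ) = 0 := hpy 1
  have Jxy : (inner ℝ (cross p x) y : ℝ) = 0 := hpy 2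
  have yx : (inner ℝ y x : ℝ) = 0 := by rw [real_inner_comm, xy]
  -- This is why y is taken orthogonal to p × x: ⟨p, x × y⟩ = ⟨p × x, y⟩.
  have pz : (inner ℝ p (cross x y) : ℝ) = 0 := by
    rw [real_inner_comm, ← inner_cross_rotate, Jxy]
  have xz : (inner ℝ x (cross x y) : ℝ) = 0 := inner_cross_self_left x y
  have yz : (inner ℝ y (cross x y) : ℝ) = 0 := by
    rw [cross_swap, inner_neg_right, inner_cross_self_left, neg_zero]
  have zz : (inner ℝ (cross x y) (cross x y) : ℝ) = 1 := by
    rw [inner_cross_cross_same, hx, hy, xy]; norm_num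
  have xJy : (inner ℝ x (cross p y) : ℝ) = 0 := by
    rw [← neg_eq_zero, ← inner_cross_left, Jxy]
  have hJx : (inner ℝ (cross p x) (cross x y) : ℝ) = 0 := by
    rw [cross_swap p x, inner_neg_left, inner_cross_cross_same, py, real_inner_comm p x, px]; simp
  have hJy : (inner ℝ (cross p y) (cross x y) : ℝ) = 0 := by
    rw [cross_swap p y, cross_swap x y, inner_neg_left, inner_neg_right, inner_cross_cross_same,
      px, real_inner_comm p y, py]; simp
  have self : ∀ z : E7, (inner ℝ z (cross p z) : ℝ) = 0 := fun z => by
    rw [cross_swap, inner_neg_right, inner_cross_self_left, neg_zero]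
  have xJz : (inner ℝ x (cross p (cross x y)) : ℝ) = 0 := by
    rw [← neg_eq_zero, ← inner_cross_left, hJx]
  have yJz : (inner ℝ y (cross p (cross x y)) : ℝ) = 0 := by
    rw [← neg_eq_zero, ← inner_cross_left, hJy]
  have yJx : (inner ℝ y (cross p x) : ℝ) = 0 := by rw [real_inner_comm, Jxy]
  have zJx : (inner ℝ (cross x y) (cross p x) : ℝ) = 0 := by rw [real_inner_comm, hJx]
  have zJy : (inner ℝ (cross x y) (cross p y) : ℝ) = 0 := by rw [real_inner_comm, hJy]
  have zx : (inner ℝ (cross x y) x : ℝ) = 0 := by rw [real_inner_comm, xz]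
  have zy : (inner ℝ (cross x y) y : ℝ) = 0 := by rw [real_inner_comm, yz]
  refine ⟨![x, y, cross x y], hp, ?_, ?_, ?_, rfl⟩
  · intro i
    fin_cases i <;> assumption
  · intro i j
    fin_cases i <;> fin_cases j
    exacts [hx, xy, xz, yx, hy, yz, zx, zy, zz]
  · intro i j
    fin_cases i <;> fin_cases j <;> simp [self, xJy, xJz, yJx, yJz, zJx, zJy]

section J

variable {p : E7} (hp : (inner ℝ p p : ℝ) = 1)
include hp

theorem inner_cross_cross_unit {u v : E7} (hu : (inner ℝ p u : ℝ) = 0) :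
    (inner ℝ (cross p u) (cross p v) : ℝ) = inner ℝ u v := by
  rw [inner_cross_cross_same, hp, hu]; ring

theorem cross_cross_unit {u : E7} (hu : (inner ℝ p u : ℝ) = 0) : cross p (cross p u) = -u := by
  rw [cross_cross, hp, hu]; simp

end J

/-- All correction terms of `inner_cross_cross` contain an inner product with p. Thus φ(Ju, v, w) =
φ(u, v, Jw) on p^⊥, as for the real part of a complex trilinear form. -/
theorem inner_cross_J_left {p u v w : E7} (hu : (inner ℝ p u : ℝ) = 0)
    (hv : (inner ℝ p v : ℝ) = 0) (hw : (inner ℝ p w : ℝ) = 0) :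
    (inner ℝ (cross (cross p u) v) w : ℝ) = inner ℝ (cross u v) (cross p w) := by
  rw [inner_cross_rotate, real_inner_comm, inner_cross_cross, hu, hv, hw]; ring

theorem inner_cross_J_right {p u v w : E7} (hu : (inner ℝ p u : ℝ) = 0)
    (hv : (inner ℝ p v : ℝ) = 0) (hw : (inner ℝ p w : ℝ) = 0) :
    (inner ℝ (cross u (cross p v)) w : ℝ) = inner ℝ (cross u v) (cross p w) := by
  rw [cross_swap, inner_neg_left, inner_cross_J_left hv hu hw, cross_swap v u, inner_neg_left,
    neg_neg]

namespace IsAdapted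

variable {p : E7} {a : Fin 3 → E7} (h : IsAdapted p a)
include h

theorem orthJJ (i j : Fin 3) :
    (inner ℝ (cross p (a i)) (cross p (a j)) : ℝ) = if i = j then 1 else 0 := by
  rw [inner_cross_cross_unit h.norm (h.perp i), h.orth]

theorem orthJ' (i j : Fin 3) : (inner ℝ (cross p (a i)) (a j) : ℝ) = 0 := by
  rw [real_inner_comm, h.orthJ]

theorem perp' (i : Fin 3) : (inner ℝ (a i) p : ℝ) = 0 := by
  rw [real_inner_comm, h.perp]

omit h in
theorem inner_frame_J (i : Fin 3) (w : E7) :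
    (inner ℝ (a i) (cross p w) : ℝ) = -inner ℝ (cross p (a i)) w := by
  rw [inner_cross_left, neg_neg]

/-- Every vector is the sum of its components in an adapted frame. -/
theorem eq_sum (u : E7) : u = (inner ℝ p u : ℝ) • p + ∑ i, (inner ℝ (a i) u : ℝ) • a i
    + ∑ i, (inner ℝ (cross p (a i)) u : ℝ) • cross p (a i) := by
  let f : Unit ⊕ Fin 3 ⊕ Fin 3 → E7 :=
    Sum.elim (fun _ => p) (Sum.elim a fun i => cross p (a i))
  have hf : Orthonormal ℝ f := by
    rw [orthonormal_iff_ite]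
    have hs := inner_cross_self_left p
    have hs' : ∀ v, (inner ℝ (cross p v) p : ℝ) = 0 := fun v => by rw [real_inner_comm, hs]
    rintro (i | i | i) (j | j | j) <;>
      simp [f, h.norm, h.perp, h.perp', h.orth, h.orthJ, h.orthJ', h.orthJJ, hs, hs',
        -inner_self_eq_norm_sq_to_K]
  have hcard : Fintype.card (Unit ⊕ Fin 3 ⊕ Fin 3) = Module.finrank ℝ E7 := by simp
  let b := OrthonormalBasis.mk hf
    (hf.linearIndependent.span_eq_top_of_card_eq_finrank' hcard).ge
  have := b.sum_repr' u
  simpa [b, f, Fintype.sum_sum_type, add_assoc] using this.symm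

theorem inner_eq (u v : E7) : (inner ℝ u v : ℝ) = inner ℝ p u * inner ℝ p v +
    ∑ i, inner ℝ (a i) u * inner ℝ (a i) v
      + ∑ i, inner ℝ (cross p (a i)) u * inner ℝ (cross p (a i)) v := by
  conv_lhs => rw [h.eq_sum u]
  simp only [inner_add_left, sum_inner, inner_smul_left]
  simp

theorem sigma_eq (u v : E7) : (inner ℝ (cross p u) v : ℝ) =
    ∑ i, (inner ℝ (a i) u * inner ℝ (cross p (a i)) v
      - inner ℝ (cross p (a i)) u * inner ℝ (a i) v) := by
  rw [h.inner_eq, inner_cross_self_left]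
  simp only [inner_frame_J, inner_cross_cross_unit h.norm (h.perp _), Finset.sum_sub_distrib]
  simp
  ring

theorem cross_one_two : cross (a 1) (a 2) = a 0 := by
  rw [← h.cross_eq, cross_swap (a 0), map_neg, cross_cross, h.orth, h.orth]; simp

theorem cross_two_zero : cross (a 2) (a 0) = a 1 := by
  rw [cross_swap, ← h.cross_eq, cross_cross, h.orth, h.orth]; simp

/-- The frame vectors multiply cyclically, so × restricts to their real span as the usual cross
product of ℝ³. -/
theorem cross_span (x y : Fin 3 → ℝ) : cross (∑ i, x i • a i) (∑ i, y i • a i) =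
    (x 1 * y 2 - x 2 * y 1) • a 0 + (x 2 * y 0 - x 0 * y 2) • a 1
      + (x 0 * y 1 - x 1 * y 0) • a 2 := by
  simp only [Fin.sum_univ_three, map_add, map_smul, cross_add_left, cross_smul_left, cross_self]
  rw [cross_swap (a 1) (a 0), cross_swap (a 2) (a 1), cross_swap (a 0) (a 2), h.cross_eq,
    h.cross_one_two, h.cross_two_zero]
  module

/-- The right side is the real part of det (A + iB) evaluated on u, v, w, grouped by the components
of w. With u and v split into parts x + Jx', moving every J onto w leaves cross products in the span
of the frame. -/
theorem phi_eq {u v w : E7} (hu : (inner ℝ p u : ℝ) = 0) (hv : (inner ℝ p v : ℝ) = 0)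
    (hw : (inner ℝ p w : ℝ) = 0) {A B : Fin 3 → E7 → ℝ} (hA : ∀ i z, A i z = inner ℝ (a i) z)
    (hB : ∀ i z, B i z = inner ℝ (cross p (a i)) z) : (inner ℝ (cross u v) w : ℝ) =
      (A 1 u * A 2 v - A 2 u * A 1 v - (B 1 u * B 2 v - B 2 u * B 1 v)) * A 0 w
      + (A 2 u * A 0 v - A 0 u * A 2 v - (B 2 u * B 0 v - B 0 u * B 2 v)) * A 1 w
      + (A 0 u * A 1 v - A 1 u * A 0 v - (B 0 u * B 1 v - B 1 u * B 0 v)) * A 2 w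
      - (A 1 u * B 2 v - A 2 u * B 1 v + (B 1 u * A 2 v - B 2 u * A 1 v)) * B 0 w
      - (A 2 u * B 0 v - A 0 u * B 2 v + (B 2 u * A 0 v - B 0 u * A 2 v)) * B 1 w
      - (A 0 u * B 1 v - A 1 u * B 0 v + (B 0 u * A 1 v - B 1 u * A 0 v)) * B 2 w := by
  have hs : ∀ x : Fin 3 → ℝ, (inner ℝ p (∑ i, x i • a i) : ℝ) = 0 := fun x => by
    simp [inner_sum, inner_smul_right, h.perp]
  have hJ : ∀ z : E7, (inner ℝ p (cross p z) : ℝ) = 0 := inner_cross_self_left p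
  have dec : ∀ z : E7, (inner ℝ p z : ℝ) = 0 →
      z = ∑ i, A i z • a i + cross p (∑ i, B i z • a i) := fun z hz => by
    conv_lhs => rw [h.eq_sum z, hz, zero_smul, zero_add]
    simp only [hA, hB, map_sum, map_smul]
  have e : (inner ℝ (cross u v) w : ℝ) =
      inner ℝ (cross (∑ i, A i u • a i) (∑ i, A i v • a i)) w
      + inner ℝ (cross (∑ i, A i u • a i) (∑ i, B i v • a i)) (cross p w)
      + inner ℝ (cross (∑ i, B i u • a i) (∑ i, A i v • a i)) (cross p w)
      - inner ℝ (cross (∑ i, B i u • a i) (∑ i, B i v • a i)) w := by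
    -- The term with J in both factors moves J² onto w, whence the minus sign.
    conv_lhs => rw [dec u hu, dec v hv]
    rw [cross_add_left, map_add, map_add, inner_add_left, inner_add_left, inner_add_left,
      inner_cross_J_right (hs _) (hs _) hw, inner_cross_J_left (hs _) (hs _) hw,
      inner_cross_J_left (hs _) (hJ _) hw, inner_cross_J_right (hs _) (hs _) (hJ _),
      cross_cross_unit h.norm hw, inner_neg_right]
    ring
  rw [e]
  have hAJ : ∀ i, A i (cross p w) = -B i w := fun i => by rw [hA, hB, inner_frame_J]
  simp only [h.cross_span, inner_add_left, inner_smul_left, ← hA, hAJ]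
  simp
  ring

/-- On `p^⊥`, `⋆φ = σ ∧ σ / 2`. -/
theorem starPhi_eq {v : Fin 4 → E7} (hv : ∀ i, (inner ℝ p (v i) : ℝ) = 0)
    {S : E7 → E7 → ℝ} (hS : ∀ x y, S x y = inner ℝ (cross p x) y) :
    starPhi v = S (v 0) (v 1) * S (v 2) (v 3) - S (v 0) (v 2) * S (v 1) (v 3)
      + S (v 0) (v 3) * S (v 1) (v 2) := by
  have e : v = ![v 0, v 1, v 2, v 3] := by
    ext a : 1
    fin_cases a <;> rfl
  have hp : ∀ x y : E7, (inner ℝ p (cross x y) : ℝ) = inner ℝ (cross p x) y := fun x y => by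
    rw [real_inner_comm, ← inner_cross_rotate]
  have hJ : ∀ i, (inner ℝ p (cross p (a i)) : ℝ) = 0 := fun i => inner_cross_self_left p _
  have key : ∀ (i j : Fin 4) (z : E7), (inner ℝ p z : ℝ) = 0 → _ := fun i j z hz =>
    h.phi_eq (hv i) (hv j) hz (fun _ _ => rfl) (fun _ _ => rfl)
  have kA : ∀ (i j : Fin 4) k, _ := fun i j k =>
    (real_inner_comm _ _).trans (key i j (a k) (h.perp k))
  have kB : ∀ (i j : Fin 4) k, _ := fun i j k =>
    (real_inner_comm _ _).trans (key i j (cross p (a k)) (hJ k))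
  simp only [h.orth, h.orthJ, h.orthJ', h.orthJJ] at kA kB
  conv_lhs => rw [e]
  -- Expand ⟨v₀ × v₁, v₂ × v₃⟩ in the frame. The p-components give S(v₀, v₁) S(v₂, v₃); the others
  -- are values of φ on p^⊥, known from `phi_eq`.
  rw [starPhi_eq_inner_cross, h.inner_eq (cross _ _), hp, hp, ← hS, ← hS, Fin.sum_univ_three,
    Fin.sum_univ_three]
  simp only [kA, kB]
  rw [h.inner_eq (v 0) (v 2), h.inner_eq (v 1) (v 3), h.inner_eq (v 0) (v 3),
    h.inner_eq (v 1) (v 2)]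
  rw [hS (v 0) (v 2), hS (v 1) (v 3), hS (v 0) (v 3), hS (v 1) (v 2)]
  rw [h.sigma_eq (v 0) (v 2), h.sigma_eq (v 1) (v 3), h.sigma_eq (v 0) (v 3),
    h.sigma_eq (v 1) (v 2)]
  simp only [Fin.sum_univ_three, hv]
  simp
  ring

end IsAdapted

/-! ### The exterior product of two two-forms. -/

theorem map_perm_fin_four : (Finset.univ : Finset (Equiv.Perm (Fin 4))).val.map
    (fun s => ((Equiv.Perm.sign s : ℤ), s 0, s 1, s 2, s 3)) =
    {(1, 0, 1, 2, 3), (-1, 0, 1, 3, 2), (-1, 1, 0, 2, 3), (1, 1, 0, 3, 2),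
     (-1, 0, 2, 1, 3), (1, 0, 2, 3, 1), (1, 2, 0, 1, 3), (-1, 2, 0, 3, 1),
     (1, 0, 3, 1, 2), (-1, 0, 3, 2, 1), (-1, 3, 0, 1, 2), (1, 3, 0, 2, 1),
     (1, 1, 2, 0, 3), (-1, 1, 2, 3, 0), (-1, 2, 1, 0, 3), (1, 2, 1, 3, 0),
     (-1, 1, 3, 0, 2), (1, 1, 3, 2, 0), (1, 3, 1, 0, 2), (-1, 3, 1, 2, 0),
     (1, 2, 3, 0, 1), (-1, 2, 3, 1, 0), (-1, 3, 2, 0, 1), (1, 3, 2, 1, 0)} := by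
  decide +kernel

theorem sum_perm_fin_four (f : Fin 4 → Fin 4 → Fin 4 → Fin 4 → ℝ) :
    ∑ s : Equiv.Perm (Fin 4), ((Equiv.Perm.sign s : ℤ) : ℝ) * f (s 0) (s 1) (s 2) (s 3) =
      f 0 1 2 3 - f 0 1 3 2 - f 1 0 2 3 + f 1 0 3 2
      - f 0 2 1 3 + f 0 2 3 1 + f 2 0 1 3 - f 2 0 3 1
      + f 0 3 1 2 - f 0 3 2 1 - f 3 0 1 2 + f 3 0 2 1
      + f 1 2 0 3 - f 1 2 3 0 - f 2 1 0 3 + f 2 1 3 0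
      - f 1 3 0 2 + f 1 3 2 0 + f 3 1 0 2 - f 3 1 2 0
      + f 2 3 0 1 - f 2 3 1 0 - f 3 2 0 1 + f 3 2 1 0 := by
  have h := congrArg (fun m : Multiset (ℤ × Fin 4 × Fin 4 × Fin 4 × Fin 4) =>
    (m.map fun t => (t.1 : ℝ) * f t.2.1 t.2.2.1 t.2.2.2.1 t.2.2.2.2).sum) map_perm_fin_four
  simp only [Multiset.map_map, Function.comp_def] at h
  refine h.trans ?_
  simp
  ring

/-- The exterior product of two-forms, as an explicit sum over shuffles. -/
theorem wedge_two_apply {V : Type*} [AddCommGroup V] [Module ℝ V] [TopologicalSpace V]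
    (α β : V [⋀^Fin 2]→L[ℝ] ℝ) (v : Fin 4 → V) :
    wedge α β v = α ![v 0, v 1] * β ![v 2, v 3] - α ![v 0, v 2] * β ![v 1, v 3]
      + α ![v 0, v 3] * β ![v 1, v 2] + α ![v 1, v 2] * β ![v 0, v 3]
      - α ![v 1, v 3] * β ![v 0, v 2] + α ![v 2, v 3] * β ![v 0, v 1] := by
  -- Summing over all 24 permutations counts each shuffle 2! · 2! = 4 times, which avoids
  -- enumerating the quotient that defines the shuffles.
  have h := congrArg (fun m => LinearMap.mul' ℝ ℝ (m fun i => v (finSumFinEquiv i)))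
    (MultilinearMap.domCoprod_alternization_eq α.toAlternatingMap β.toAlternatingMap)
  have hw : wedge α β v = LinearMap.mul' ℝ ℝ
    ((α.toAlternatingMap.domCoprod β.toAlternatingMap) fun i => v (finSumFinEquiv i)) := rfl
  have h4 : LinearMap.mul' ℝ ℝ ((((Fintype.card (Fin 2)).factorial *
      (Fintype.card (Fin 2)).factorial) • α.toAlternatingMap.domCoprod β.toAlternatingMap)
        fun i => v (finSumFinEquiv i)) = 4 * wedge α β v := by
    rw [AlternatingMap.smul_apply, map_nsmul, ← hw]
    simp
  rw [h4, MultilinearMap.alternatization_apply, map_sum] at h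
  have key : ∀ s : Equiv.Perm (Fin 2 ⊕ Fin 2),
      LinearMap.mul' ℝ ℝ (Equiv.Perm.sign s • ((MultilinearMap.domCoprod
        (α.toAlternatingMap : MultilinearMap ℝ (fun _ => V) ℝ)
          (β.toAlternatingMap : MultilinearMap ℝ (fun _ => V) ℝ)).domDomCongr s)
            fun i => v (finSumFinEquiv i))
      = (Equiv.Perm.sign (finSumFinEquiv.permCongr s) : ℤ) *
        (fun i j k l => α ![v i, v j] * β ![v k, v l]) (finSumFinEquiv.permCongr s 0)
          (finSumFinEquiv.permCongr s 1) (finSumFinEquiv.permCongr s 2)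
            (finSumFinEquiv.permCongr s 3) := by
    intro s
    rw [Equiv.Perm.sign_permCongr]
    have e1 : (fun i => v (finSumFinEquiv (s (Sum.inl i)))) =
        ![v (finSumFinEquiv.permCongr s 0), v (finSumFinEquiv.permCongr s 1)] := by
      ext i : 1
      fin_cases i <;> rfl
    have e2 : (fun i => v (finSumFinEquiv (s (Sum.inr i)))) =
        ![v (finSumFinEquiv.permCongr s 2), v (finSumFinEquiv.permCongr s 3)] := by
      ext i : 1
      fin_cases i <;> rfl
    change LinearMap.mul' ℝ ℝ ((Equiv.Perm.sign s : ℤˣ) •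
      ((α fun i => v (finSumFinEquiv (s (Sum.inl i)))) ⊗ₜ[ℝ]
        (β fun i => v (finSumFinEquiv (s (Sum.inr i)))))) = _
    rw [e1, e2, Units.smul_def, map_zsmul, LinearMap.mul'_apply, zsmul_eq_mul]
  rw [Finset.sum_congr rfl fun s _ => key s] at h
  have h' : ∑ t : Equiv.Perm (Fin 4), ((Equiv.Perm.sign t : ℤ) : ℝ) *
      (fun i j k l => α ![v i, v j] * β ![v k, v l]) (t 0) (t 1) (t 2) (t 3) =
        4 * wedge α β v := by
    rw [← h]
    exact (Fintype.sum_equiv (finSumFinEquiv (m := 2) (n := 2)).permCongr _ _ fun s => rfl).symm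
  replace h' := (sum_perm_fin_four fun i j k l => α ![v i, v j] * β ![v k, v l]).symm.trans h'
  have swap : ∀ (γ : V [⋀^Fin 2]→L[ℝ] ℝ) (x y : V), γ ![x, y] = -γ ![y, x] := fun γ x y => by
    have := γ.map_swap ![y, x] (i := 0) (j := 1) (by decide)
    refine Eq.trans (congrArg γ.toAlternatingMap ?_) this
    ext i : 1
    fin_cases i <;> rfl
  rw [swap α (v 1) (v 0), swap α (v 2) (v 0), swap α (v 3) (v 0), swap α (v 2) (v 1),
    swap α (v 3) (v 1), swap α (v 3) (v 2), swap β (v 1) (v 0), swap β (v 2) (v 0),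
    swap β (v 3) (v 0), swap β (v 2) (v 1), swap β (v 3) (v 1), swap β (v 3) (v 2)] at h'
  linear_combination -(1 / 4) * h'

/-! ### Forms on the sphere as pull-backs by chart inverses. -/

/-- A form is determined linearly by its finitely many values on tuples of basis vectors; a linear
left inverse of this evaluation is continuous, its source being finite-dimensional. -/
theorem contDiffOn_continuousAlternatingMap {E V : Type*} [NormedAddCommGroup E] [NormedSpace ℝ E]
    [NormedAddCommGroup V] [NormedSpace ℝ V] [FiniteDimensional ℝ V] {k : ℕ} {n : ℕ∞ω}
    {f : E → V [⋀^Fin k]→L[ℝ] ℝ} {s : Set E} (h : ∀ v, ContDiffOn ℝ n (fun y => f y v) s) :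
    ContDiffOn ℝ n f s := by
  let b := Module.finBasis ℝ V
  let Φ : (V [⋀^Fin k]→L[ℝ] ℝ) →ₗ[ℝ] ((Fin k → Fin (Module.finrank ℝ V)) → ℝ) :=
    { toFun := fun η i => η fun a => b (i a)
      map_add' := fun _ _ => rfl
      map_smul' := fun _ _ => rfl }
  have hΦ : LinearMap.ker Φ = ⊥ := by
    rw [LinearMap.ker_eq_bot]
    intro η η' hη
    apply ContinuousAlternatingMap.toAlternatingMap_injective
    apply AlternatingMap.coe_multilinearMap_injective
    exact Module.Basis.ext_multilinear (fun _ => b) fun i => congrFun hη i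
  obtain ⟨Ψ, hΨ⟩ := Φ.exists_leftInverse_of_injective hΦ
  have e : f = fun y => LinearMap.toContinuousLinearMap Ψ (Φ (f y)) := by
    ext1 y
    exact (LinearMap.congr_fun hΨ (f y)).symm
  rw [e]
  exact (LinearMap.toContinuousLinearMap Ψ).contDiff.comp_contDiffOn
    (contDiffOn_pi.2 fun i => h _)

/-- The map y ↦ η(y, ·) is its own derivative, and alternating the already alternating η over the k
+ 1 positions of the first argument multiplies it by k + 1. -/
theorem extDeriv_curryLeft {E : Type*} [NormedAddCommGroup E] [NormedSpace ℝ E] {k : ℕ}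
    (η : E [⋀^Fin (k + 1)]→L[ℝ] ℝ) (x : E) :
    extDeriv (fun y => η.curryLeft y) x = (k + 1) • η := by
  rw [extDeriv, (η.curryLeft).fderiv]
  exact ContinuousAlternatingMap.alternatizeUncurryFin_curryLeft η

/-- The inverse of a chart of the sphere, as a map into `ℝ⁷`. -/
def param (e : OpenPartialHomeomorph S6 (EuclideanSpace ℝ (Fin 6)))
    (y : EuclideanSpace ℝ (Fin 6)) : E7 := e.symm y

instance finrank_E7 : Fact (Module.finrank ℝ E7 = 6 + 1) := ⟨finrank_euclideanSpace_fin⟩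

theorem contMDiff_val : ContMDiff (𝓡 6) 𝓘(ℝ, E7) ∞ (Subtype.val : S6 → E7) :=
  contMDiff_coe_sphere

theorem mdifferentiableAt_val (p : S6) :
    MDifferentiableAt (𝓡 6) 𝓘(ℝ, E7) (Subtype.val : S6 → E7) p :=
  (contMDiff_val p).mdifferentiableAt (by simp)

section Chart

variable {e : OpenPartialHomeomorph S6 (EuclideanSpace ℝ (Fin 6))}
  (he : e ∈ IsManifold.maximalAtlas (𝓡 6) ∞ S6)
include he

theorem contDiffOn_param : ContDiffOn ℝ ∞ (param e) e.target := by
  rw [← contMDiffOn_iff_contDiffOn]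
  exact contMDiff_val.comp_contMDiffOn (contMDiffOn_symm_of_mem_maximalAtlas he)

theorem contDiffAt_param {y : EuclideanSpace ℝ (Fin 6)} (hy : y ∈ e.target) :
    ContDiffAt ℝ ∞ (param e) y :=
  (contDiffOn_param he).contDiffAt (e.open_target.mem_nhds hy)

theorem contDiffOn_fderiv_param : ContDiffOn ℝ ∞ (fderiv ℝ (param e)) e.target :=
  (contDiffOn_param he).fderiv_of_isOpen e.open_target (by simp)

theorem dIota_chartInvDeriv {y : EuclideanSpace ℝ (Fin 6)} (hy : y ∈ e.target)
    (a : EuclideanSpace ℝ (Fin 6)) :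
    dIota (e.symm y) (chartInvDeriv e y a) = fderiv ℝ (param e) y a := by
  have h := mfderiv_comp y (mdifferentiableAt_val (e.symm y))
    ((contMDiffAt_symm_of_mem_maximalAtlas he hy).mdifferentiableAt (by simp))
  have h2 : mfderiv (𝓡 6) 𝓘(ℝ, E7) (Subtype.val ∘ e.symm) y = fderiv ℝ (param e) y :=
    mfderiv_eq_fderiv
  exact (DFunLike.congr_fun (h.symm.trans h2) a)

theorem fderiv_param_chartDeriv {p : S6} (hp : p ∈ e.source) (v : TangentSpace (𝓡 6) p) :
    fderiv ℝ (param e) (e p) (chartDeriv e p v) = dIota p v := by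
  have hy := e.map_source hp
  have h := mfderiv_comp (I := 𝓡 6) (I' := 𝓡 6) (I'' := 𝓘(ℝ, E7)) (f := e) (g := param e) p
    ((contDiffAt_param he hy).differentiableAt (by simp)).mdifferentiableAt
    ((contMDiffAt_of_mem_maximalAtlas he hp).mdifferentiableAt (by simp))
  have h2 : param e ∘ e =ᶠ[nhds p] Subtype.val := by
    filter_upwards [e.open_source.mem_nhds hp] with q hq
    exact congrArg Subtype.val (e.left_inv hq)
  rw [h2.mfderiv_eq, mfderiv_eq_fderiv] at h
  exact (DFunLike.congr_fun h v).symm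

/-- With F = `param e`, the identity dF ∘ de = dι makes de injective, hence bijective between
six-dimensional spaces; injectivity of dι then passes to dF. -/
theorem injective_fderiv_param {y : EuclideanSpace ℝ (Fin 6)} (hy : y ∈ e.target) :
    Function.Injective (fderiv ℝ (param e) y) := by
  have hs := e.map_target hy
  have h1 : Function.Injective (chartDeriv e (e.symm y)) := by
    intro v w h
    apply dIota_injective (e.symm y)
    rw [← fderiv_param_chartDeriv he hs, ← fderiv_param_chartDeriv he hs, h]
  let L : EuclideanSpace ℝ (Fin 6) →L[ℝ] EuclideanSpace ℝ (Fin 6) := chartDeriv e (e.symm y)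
  have h2 : Function.Surjective L := LinearMap.injective_iff_surjective (f := L.toLinearMap).1 h1
  intro a b hab
  obtain ⟨v, rfl⟩ := h2 a
  obtain ⟨w, rfl⟩ := h2 b
  congr 1
  apply dIota_injective (e.symm y)
  have hv := fderiv_param_chartDeriv he hs v
  have hw := fderiv_param_chartDeriv he hs w
  rw [e.right_inv hy] at hv hw
  exact hv.symm.trans (hab.trans hw)

theorem contDiffOn_fderiv_param_apply (a : EuclideanSpace ℝ (Fin 6)) :
    ContDiffOn ℝ ∞ (fun y => fderiv ℝ (param e) y a) e.target :=
  (contDiffOn_fderiv_param he).clm_apply contDiffOn_const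

theorem isRiemannian_smooth (a b : EuclideanSpace ℝ (Fin 6)) :
    ContDiffOn ℝ ∞ (fun y => g (e.symm y) (chartInvDeriv e y a) (chartInvDeriv e y b))
      e.target := by
  refine ((contDiffOn_fderiv_param_apply he a).inner ℝ (contDiffOn_fderiv_param_apply he b)).congr
    fun y hy => ?_
  rw [g_apply, dIota_chartInvDeriv he hy, dIota_chartInvDeriv he hy]

/-- N is the position vector, so g(JX, Y) = φ(N, X, Y) is a contraction of φ with `param e`. -/
theorem inChart_sigma {y : EuclideanSpace ℝ (Fin 6)} (hy : y ∈ e.target) :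
    inChart sigma e y =
      (phi.curryLeft (param e y)).compContinuousLinearMap (fderiv ℝ (param e) y) := by
  ext v
  change inner ℝ (dIota (e.symm y) (J (e.symm y) (chartInvDeriv e y (v 0))))
    (dIota (e.symm y) (chartInvDeriv e y (v 1))) = phi _
  rw [dIota_J, dIota_chartInvDeriv he hy, dIota_chartInvDeriv he hy, inner_cross]
  congr 1
  ext i : 1
  fin_cases i <;> rfl

theorem inChart_psiPlus {y : EuclideanSpace ℝ (Fin 6)} (hy : y ∈ e.target) :
    inChart psiPlus e y = phi.compContinuousLinearMap (fderiv ℝ (param e) y) := by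
  ext v
  change phi (fun i => dIota (e.symm y) (chartInvDeriv e y (v i))) = phi _
  simp only [dIota_chartInvDeriv he hy]
  rfl

theorem inChart_psiMinus {y : EuclideanSpace ℝ (Fin 6)} (hy : y ∈ e.target) :
    inChart psiMinus e y =
      ((-starPhi).curryLeft (param e y)).compContinuousLinearMap (fderiv ℝ (param e) y) := by
  ext v
  change -(starPhi.curryLeft (normal (e.symm y))
    fun i => dIota (e.symm y) (chartInvDeriv e y (v i))) = _
  simp only [dIota_chartInvDeriv he hy]
  rfl

theorem contDiffOn_pullback {k : ℕ} (η : E7 [⋀^Fin k]→L[ℝ] ℝ) :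
    ContDiffOn ℝ ∞ (fun y => η.compContinuousLinearMap (fderiv ℝ (param e) y)) e.target :=
  contDiffOn_continuousAlternatingMap fun v =>
    η.toContinuousMultilinearMap.contDiff.comp_contDiffOn (contDiffOn_pi.2 fun i =>
      contDiffOn_fderiv_param_apply he (v i))

theorem contDiffOn_pullback_curryLeft {k : ℕ} (η : E7 [⋀^Fin (k + 1)]→L[ℝ] ℝ) :
    ContDiffOn ℝ ∞ (fun y => (η.curryLeft (param e y)).compContinuousLinearMap
      (fderiv ℝ (param e) y)) e.target := by
  refine contDiffOn_continuousAlternatingMap fun v =>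
    η.toContinuousMultilinearMap.contDiff.comp_contDiffOn (contDiffOn_pi.2 fun i => ?_)
  refine Fin.cases ?_ (fun i => ?_) i
  · exact contDiffOn_param he
  · exact contDiffOn_fderiv_param_apply he (v i)

/-- Naturality of d reduces the claim to `extDeriv_curryLeft` on ℝ⁷; composing with the chart
differential turns dF back into dι. -/
theorem extD_eq_of_inChart {k : ℕ} {η : Form 6 S6 k} {θ : E7 [⋀^Fin (k + 1)]→L[ℝ] ℝ}
    (h : ∀ y ∈ e.target, inChart η e y =
      (θ.curryLeft (param e y)).compContinuousLinearMap (fderiv ℝ (param e) y))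
    {p : S6} (hp : p ∈ e.source) :
    (extDeriv (inChart η e) (e p)).compContinuousLinearMap (chartDeriv e p) =
      ((k + 1) • θ).compContinuousLinearMap (dIota p) := by
  have hy := e.map_source hp
  have h1 : inChart η e =ᶠ[nhds (e p)] fun y =>
      (θ.curryLeft (param e y)).compContinuousLinearMap (fderiv ℝ (param e) y) := by
    filter_upwards [e.open_target.mem_nhds hy] with y hy using h y hy
  have hθ : DifferentiableAt ℝ (fun x => θ.curryLeft x) (param e (e p)) :=
    θ.curryLeft.differentiableAt
  have hr : minSmoothness ℝ 2 ≤ ∞ := by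
    rw [minSmoothness_of_isRCLikeNormedField]
    exact WithTop.coe_le_coe.2 (le_top : (2 : ℕ∞) ≤ ⊤)
  rw [h1.extDeriv_eq, extDeriv_pullback hθ (contDiffAt_param he hy) hr, extDeriv_curryLeft]
  ext v
  change ((k + 1) • θ) (fun i => fderiv ℝ (param e) (e p) (chartDeriv e p (v i))) = _
  simp only [fderiv_param_chartDeriv he hp]
  rfl

end Chart

/-! ### Smoothness and the structure equations. -/

theorem isSmoothForm_sigma : IsSmoothForm sigma := fun _ he =>
  (contDiffOn_pullback_curryLeft he phi).congr fun _ hy => inChart_sigma he hy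

theorem isSmoothForm_psiPlus : IsSmoothForm psiPlus := fun _ he =>
  (contDiffOn_pullback he phi).congr fun _ hy => inChart_psiPlus he hy

theorem isSmoothForm_psiMinus : IsSmoothForm psiMinus := fun _ he =>
  (contDiffOn_pullback_curryLeft he (-starPhi)).congr fun _ hy => inChart_psiMinus he hy

theorem chartAt_mem (p : S6) :
    chartAt (EuclideanSpace ℝ (Fin 6)) p ∈ IsManifold.maximalAtlas (𝓡 6) ∞ S6 :=
  IsManifold.chart_mem_maximalAtlas p

theorem inner_dIota (p : S6) (v : TangentSpace (𝓡 6) p) :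
    (inner ℝ (normal p) (dIota p v) : ℝ) = 0 := by
  have : dIota p v ∈ (dIota p).range := ⟨_, rfl⟩
  rw [range_dIota, Submodule.mem_orthogonal_singleton_iff_inner_right] at this
  exact this

theorem inner_normal (p : S6) : (inner ℝ (normal p) (normal p) : ℝ) = 1 := by
  rw [real_inner_self_eq_norm_sq, normal, norm_eq_of_mem_sphere, one_pow]

theorem sigma_apply (p : S6) (v : Fin 2 → TangentSpace (𝓡 6) p) :
    sigma p v = inner ℝ (cross (normal p) (dIota p (v 0))) (dIota p (v 1)) := by
  rw [← dIota_J]; rfl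

theorem extD_sigma (p : S6) : extD sigma p = (3 : ℝ) • psiPlus p := by
  refine (extD_eq_of_inChart (chartAt_mem p) (fun y hy => inChart_sigma (chartAt_mem p) hy)
    (mem_chart_source _ p)).trans ?_
  ext v
  change (3 : ℕ) • phi (fun i => dIota p (v i)) = (3 : ℝ) • phi (fun i => dIota p (v i))
  simp

theorem extD_psiMinus (p : S6) : extD psiMinus p = (-2 : ℝ) • wedge (sigma p) (sigma p) := by
  refine (extD_eq_of_inChart (chartAt_mem p) (fun y hy => inChart_psiMinus (chartAt_mem p) hy)
    (mem_chart_source _ p)).trans ?_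
  obtain ⟨a, ha⟩ := exists_isAdapted (normal p) (inner_normal p)
  ext v
  change (4 : ℕ) • -starPhi (fun i => dIota p (v i)) = (-2 : ℝ) • wedge (sigma p) (sigma p) v
  -- Tangent vectors lie in p^⊥, where -4 ⋆φ = -2 σ ∧ σ.
  rw [ha.starPhi_eq (fun i => inner_dIota p (v i)) (S := fun x y => inner ℝ (cross (normal p) x) y)
    fun _ _ => rfl, wedge_two_apply]
  simp only [sigma_apply]
  simp
  ring

/-! ### The almost Hermitian and SU(3)-structures. -/

/-- A solution of a smooth family of injective linear equations is smooth. -/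
theorem contDiffAt_of_injective {E F G : Type*} [NormedAddCommGroup E] [NormedSpace ℝ E]
    [NormedAddCommGroup F] [NormedSpace ℝ F] [FiniteDimensional ℝ F]
    [NormedAddCommGroup G] [NormedSpace ℝ G] [FiniteDimensional ℝ G] {n : ℕ∞ω}
    {A : E → F →L[ℝ] G} {u : E → G} {z : E → F} {x : E} (hA : ContDiffAt ℝ n A x)
    (hu : ContDiffAt ℝ n u x) (hz : ∀ᶠ y in nhds x, A y (z y) = u y)
    (hx : Function.Injective (A x)) : ContDiffAt ℝ n z x := by
  have : CompleteSpace F := FiniteDimensional.complete ℝ F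
  -- Fix a left inverse L of A(x). Near x the operator L ∘ A(y) is close to the identity, hence
  -- invertible, and z = (L ∘ A)⁻¹ (L u).
  obtain ⟨L', hL'⟩ := (A x).toLinearMap.exists_leftInverse_of_injective
    (LinearMap.ker_eq_bot.2 hx)
  let L : G →L[ℝ] F := LinearMap.toContinuousLinearMap L'
  have hL : L ∘L A x = (ContinuousLinearEquiv.refl ℝ F : F →L[ℝ] F) := by
    ext v
    exact LinearMap.congr_fun hL' v
  have hB : ContDiffAt ℝ n (fun y => L ∘L A y) x :=
    (ContinuousLinearMap.compL ℝ F G F L).contDiff.contDiffAt.comp x hA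
  have hinv : ContDiffAt ℝ n (fun y => ContinuousLinearMap.inverse (L ∘L A y)) x := by
    have h := contDiffAt_map_inverse (n := n) (ContinuousLinearEquiv.refl ℝ F)
    rw [← hL] at h
    exact h.comp x hB
  have hLu : ContDiffAt ℝ n (fun y => L (u y)) x := L.contDiff.contDiffAt.comp x hu
  refine (hinv.clm_apply hLu).congr_of_eventuallyEq ?_
  have hev : ∀ᶠ y in nhds x, L ∘L A y ∈ Set.range ((↑) : (F ≃L[ℝ] F) → F →L[ℝ] F) := by
    refine hB.continuousAt.eventually (p := fun B => B ∈ Set.range _) ?_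
    dsimp only
    rw [hL]
    exact ContinuousLinearEquiv.nhds _
  filter_upwards [hz, hev] with y hy ⟨B, hB⟩
  have hB' : L (A y (z y)) = B (z y) := (DFunLike.congr_fun hB (z y)).symm
  rw [← hy, hB', ← hB, ContinuousLinearMap.inverse_equiv]
  simp

/-- The cross product as a bilinear map. -/
def crossCLM : E7 →L[ℝ] E7 →L[ℝ] E7 := LinearMap.toContinuousLinearMap
  { toFun := cross
    map_add' := fun u u' => ContinuousLinearMap.ext fun v => cross_add_left u u' v
    map_smul' := fun c u => ContinuousLinearMap.ext fun v => cross_smul_left c u v }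

theorem J_smooth {e : OpenPartialHomeomorph S6 (EuclideanSpace ℝ (Fin 6))}
    (he : e ∈ IsManifold.maximalAtlas (𝓡 6) ∞ S6) (a : EuclideanSpace ℝ (Fin 6)) :
    ContDiffOn ℝ ∞ (fun y => chartDeriv e (e.symm y) (J (e.symm y) (chartInvDeriv e y a)))
      e.target := by
  intro y hy
  have hmem := e.open_target.mem_nhds hy
  have hu : ContDiffAt ℝ ∞ (fun y => crossCLM (param e y) (fderiv ℝ (param e) y a)) y :=
    (crossCLM.contDiff.contDiffAt.comp y (contDiffAt_param he hy)).clm_apply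
      ((contDiffOn_fderiv_param_apply he a).contDiffAt hmem)
  -- The chart expression z of J a solves dF(z) = F × dF(a), a smooth injective linear system.
  refine (contDiffAt_of_injective ((contDiffOn_fderiv_param he).contDiffAt hmem) hu ?_
    (injective_fderiv_param he hy)).contDiffWithinAt
  filter_upwards [hmem] with x hx
  have h := fderiv_param_chartDeriv he (e.map_target hx) (J (e.symm x) (chartInvDeriv e x a))
  rw [e.right_inv hx, dIota_J, dIota_chartInvDeriv he hx] at h
  exact h

theorem isRiemannian : IsRiemannian (n := 6) (M := S6) g where
  symm p v w := real_inner_comm (dIota p w) (dIota p v)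
  pos p v hv := by
    rw [g_apply]
    refine real_inner_self_pos.2 fun h => hv (dIota_injective p ?_)
    rw [h, map_zero]
  smooth _ he a b := isRiemannian_smooth he a b

theorem isAlmostHermitian : IsAlmostHermitian (n := 6) (M := S6) g J where
  riemannian := isRiemannian
  smooth _ he a := J_smooth he a
  sq p v := by
    apply dIota_injective p
    rw [dIota_J, dIota_J, cross_cross_unit (inner_normal p) (inner_dIota p v), map_neg]
  orthogonal p v w := by
    rw [g_apply, g_apply, dIota_J, dIota_J,
      inner_cross_cross_unit (inner_normal p) (inner_dIota p v)]

/-- On p^⊥ this says (p ⌟ ⋆φ)(u, v, w) = φ(u, v, Jw). If φ = Re Ω with Ω complex trilinear, the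
right side is Re(iΩ) = -Im Ω, which explains the sign in ψ₋. -/
theorem starPhi_curryLeft_apply {p : E7} {v : Fin 3 → E7}
    (hv : ∀ i, (inner ℝ p (v i) : ℝ) = 0) :
    starPhi.curryLeft p v = inner ℝ (cross (v 0) (v 1)) (cross p (v 2)) := by
  have e : Matrix.vecCons p v = ![p, v 0, v 1, v 2] := by
    ext i : 1
    fin_cases i <;> rfl
  rw [ContinuousAlternatingMap.curryLeft_apply_apply, e, starPhi_eq_inner_cross, hv 1, hv 2,
    inner_cross_cross, hv 0, hv 1, hv 2]
  ring

theorem adapted (p : S6) : ∃ e : Fin 3 → TangentSpace (𝓡 6) p,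
    (∀ i j, g p (e i) (e j) = if i = j then 1 else 0) ∧
    (∀ i j, g p (J p (e i)) (J p (e j)) = if i = j then 1 else 0) ∧
    (∀ i j, g p (e i) (J p (e j)) = 0) ∧
    ∃ a b : Fin 3 → TangentSpace (𝓡 6) p →L[ℝ] ℝ,
      (∀ i, a i = g p (e i)) ∧ (∀ i, b i = g p (J p (e i))) ∧
      sigma p = covectorWedge ![a 0, b 0] + covectorWedge ![a 1, b 1]
        + covectorWedge ![a 2, b 2] ∧
      psiPlus p = covectorWedge ![a 0, a 1, a 2] - covectorWedge ![b 0, b 1, a 2]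
        - covectorWedge ![a 0, b 1, b 2] - covectorWedge ![b 0, a 1, b 2] ∧
      psiMinus p = covectorWedge ![a 0, a 1, b 2] - covectorWedge ![b 0, b 1, b 2]
        + covectorWedge ![a 0, b 1, a 2] + covectorWedge ![b 0, a 1, a 2] := by
  obtain ⟨f, hf⟩ := exists_isAdapted (normal p) (inner_normal p)
  have hr : ∀ i, f i ∈ (dIota p).range := fun i => by
    rw [range_dIota, Submodule.mem_orthogonal_singleton_iff_inner_right]
    exact hf.perp i
  choose e he using hr
  change ∀ i, dIota p (e i) = f i at he
  refine ⟨e, ?_, ?_, ?_, fun i => g p (e i), fun i => g p (J p (e i)), fun _ => rfl,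
    fun _ => rfl, ?_, ?_, ?_⟩
  · intro i j
    rw [g_apply, he, he, hf.orth]
  · intro i j
    rw [g_apply, dIota_J, dIota_J, he, he, hf.orthJJ]
  · intro i j
    rw [g_apply, dIota_J, he, he, hf.orthJ]
  · ext v
    change sigma p v = covectorWedge _ v + covectorWedge _ v + covectorWedge _ v
    rw [sigma_apply, hf.sigma_eq]
    simp only [covectorWedge_two_apply, g_apply, dIota_J, he, Fin.sum_univ_three]
  · ext v
    change phi (fun i => dIota p (v i)) = covectorWedge _ v - covectorWedge _ v
      - covectorWedge _ v - covectorWedge _ v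
    have e3 : (fun i => dIota p (v i)) = ![dIota p (v 0), dIota p (v 1), dIota p (v 2)] := by
      ext i : 1
      fin_cases i <;> rfl
    rw [e3, ← inner_cross, hf.phi_eq (inner_dIota p _) (inner_dIota p _) (inner_dIota p _)
      (fun _ _ => rfl) (fun _ _ => rfl)]
    simp only [covectorWedge_three_apply, g_apply, dIota_J, he]
    ring
  · ext v
    change -starPhi.curryLeft (normal p) (fun i => dIota p (v i)) = covectorWedge _ v
      - covectorWedge _ v + covectorWedge _ v + covectorWedge _ v
    rw [starPhi_curryLeft_apply (fun i => inner_dIota p (v i)),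
      hf.phi_eq (inner_dIota p _) (inner_dIota p _) (inner_cross_self_left _ _)
      (fun _ _ => rfl) (fun _ _ => rfl)]
    simp only [covectorWedge_three_apply, g_apply, dIota_J, he, IsAdapted.inner_frame_J,
      inner_cross_cross_unit hf.norm (hf.perp _)]
    ring

theorem isSU3Structure : IsSU3Structure g J sigma psiPlus psiMinus where
  almostHermitian := isAlmostHermitian
  fundamental _ _ _ := rfl
  smooth_fundamental := isSmoothForm_sigma
  smooth_re := isSmoothForm_psiPlus
  smooth_im := isSmoothForm_psiMinus
  adapted := adapted

/-! ### The Levi-Civita connection as tangential derivative. -/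

theorem sub_inner_mem_range (p : S6) (x : E7) :
    x - (inner ℝ (normal p) x : ℝ) • normal p ∈ (dIota p).range := by
  rw [range_dIota, Submodule.mem_orthogonal_singleton_iff_inner_right]
  change (inner ℝ (normal p) _ : ℝ) = 0
  rw [inner_sub_right, inner_smul_right, inner_normal, mul_one, sub_self]

/-- The orthogonal projection of `ℝ⁷` to the tangent space of the sphere at `p`. -/
def tangentProj (p : S6) : E7 →L[ℝ] TangentSpace (𝓡 6) p :=
  LinearMap.toContinuousLinearMap
    ((LinearEquiv.ofInjective (dIota p : TangentSpace (𝓡 6) p →ₗ[ℝ] E7)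
        (dIota_injective p)).symm.toLinearMap ∘ₗ
      LinearMap.codRestrict _
        (LinearMap.id - (innerₛₗ ℝ (normal p)).smulRight (normal p))
        (fun x => sub_inner_mem_range p x))

theorem dIota_tangentProj (p : S6) (x : E7) :
    dIota p (tangentProj p x) = x - (inner ℝ (normal p) x : ℝ) • normal p :=
  congrArg Subtype.val (LinearEquiv.apply_symm_apply
    (LinearEquiv.ofInjective (dIota p : TangentSpace (𝓡 6) p →ₗ[ℝ] E7) (dIota_injective p))
    ⟨x - (inner ℝ (normal p) x : ℝ) • normal p, sub_inner_mem_range p x⟩)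

theorem tangentProj_dIota (p : S6) (v : TangentSpace (𝓡 6) p) : tangentProj p (dIota p v) = v := by
  apply dIota_injective p
  rw [dIota_tangentProj, inner_dIota, zero_smul, sub_zero]

/-- A vector field on the sphere, as a map to `ℝ⁷`. -/
def lift (X : ∀ p : S6, TangentSpace (𝓡 6) p) (p : S6) : E7 := dIota p (X p)

/-- The expression of a vector field in the preferred chart at `p`. -/
def localField (p : S6) (X : ∀ q : S6, TangentSpace (𝓡 6) q) :
    EuclideanSpace ℝ (Fin 6) → EuclideanSpace ℝ (Fin 6) :=
  VectorField.mpullbackWithin 𝓘(ℝ, EuclideanSpace ℝ (Fin 6)) (𝓡 6) (extChartAt (𝓡 6) p).symm X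
    (Set.range (𝓡 6))

/-- The preferred chart at `p`. -/
abbrev chart (p : S6) : OpenPartialHomeomorph S6 (EuclideanSpace ℝ (Fin 6)) :=
  chartAt (EuclideanSpace ℝ (Fin 6)) p

theorem chart_mem (p : S6) : chart p p ∈ (chart p).target :=
  (chart p).map_source (mem_chart_source _ p)

theorem fderiv_param_localField (p : S6) (X : ∀ q : S6, TangentSpace (𝓡 6) q)
    {y : EuclideanSpace ℝ (Fin 6)} (hy : y ∈ (chart p).target) :
    fderiv ℝ (param (chart p)) y (localField p X y) = lift X ((chart p).symm y) := by
  rw [← dIota_chartInvDeriv (chartAt_mem p) hy]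
  have h1 := isInvertible_mfderivWithin_extChartAt_symm (I := 𝓡 6) (x := p) (y := y)
    (by simpa [extChartAt] using hy)
  have h2 : chartInvDeriv (chart p) y = mfderivWithin 𝓘(ℝ, EuclideanSpace ℝ (Fin 6)) (𝓡 6)
      (extChartAt (𝓡 6) p).symm (Set.range (𝓡 6)) y := by
    have : Set.range (𝓡 6) = Set.univ := by simp
    rw [this, mfderivWithin_univ]
    rfl
  have h3 : chartInvDeriv (chart p) y (localField p X y) = X ((chart p).symm y) := by
    rw [h2]
    exact h1.self_apply_inverse _
  rw [h3]
  rfl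

theorem chart_preimage_eq_univ (p : S6) :
    (extChartAt (𝓡 6) p).symm ⁻¹' Set.univ ∩ Set.range (𝓡 6) = Set.univ := by
  simp

theorem differentiableAt_localField {p : S6} {X : ∀ q : S6, TangentSpace (𝓡 6) q}
    (hX : IsDiffVectorFieldAt X p) : DifferentiableAt ℝ (localField p X) (chart p p) := by
  have := MDifferentiableWithinAt.differentiableWithinAt_mpullbackWithin_vectorField
    (s := Set.univ) (I := 𝓡 6) hX.mdifferentiableWithinAt
  rw [chart_preimage_eq_univ] at this
  exact differentiableWithinAt_univ.1 this

/-- The tangent space at p is modelled on ℝ⁶ through the preferred chart at p, whose differential at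
p is thus the identity. -/
theorem fderiv_param_chart (p : S6) (v : TangentSpace (𝓡 6) p) :
    fderiv ℝ (param (chart p)) (chart p p) v = dIota p v := by
  have h := fderiv_param_chartDeriv (chartAt_mem p) (mem_chart_source _ p) v
  have h2 : chartDeriv (chart p) p v = v :=
    DFunLike.congr_fun (mfderiv_extChartAt_self (I := 𝓡 6) (x := p)) v
  rw [← h]
  exact congrArg _ h2.symm

theorem localField_self (p : S6) (X : ∀ q : S6, TangentSpace (𝓡 6) q) :
    localField p X (chart p p) = X p := by
  apply injective_fderiv_param (chartAt_mem p) (chart_mem p)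
  rw [fderiv_param_localField p X (chart_mem p)]
  refine Eq.trans ?_ (fderiv_param_chart p (X p)).symm
  exact congrArg (lift X) ((chart p).left_inv (mem_chart_source _ p))

theorem mvfderiv_eq_fderiv {F : Type*} [NormedAddCommGroup F] [NormedSpace ℝ F]
    {p : S6} {f : S6 → F} (hf : MDifferentiableAt (𝓡 6) 𝓘(ℝ, F) f p) (v : TangentSpace (𝓡 6) p) :
    mvfderiv (𝓡 6) f p v = fderiv ℝ (f ∘ (chart p).symm) (chart p p) v := by
  rw [hf.mvfderiv, ← fderivWithin_univ]
  congr 2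
  simp

theorem mdifferentiableAt_iff_chart {F : Type*} [NormedAddCommGroup F] [NormedSpace ℝ F]
    {p : S6} {f : S6 → F} : MDifferentiableAt (𝓡 6) 𝓘(ℝ, F) f p ↔
      DifferentiableAt ℝ (f ∘ (chart p).symm) (chart p p) := by
  constructor
  · intro h
    have := h.mdifferentiableWithinAt.differentiableWithinAt_comp_extChartAt_symm (s := Set.univ)
    rw [chart_preimage_eq_univ] at this
    exact differentiableWithinAt_univ.1 this
  · intro h
    rw [← mdifferentiableWithinAt_univ]
    apply DifferentiableWithinAt.mdifferentiableWithinAt_of_comp_extChartAt_symm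
    rw [chart_preimage_eq_univ]
    exact differentiableWithinAt_univ.2 h

theorem lift_comp_chart_symm_eventuallyEq (p : S6) (X : ∀ q : S6, TangentSpace (𝓡 6) q) :
    lift X ∘ (chart p).symm =ᶠ[nhds (chart p p)]
      fun y => fderiv ℝ (param (chart p)) y (localField p X y) := by
  filter_upwards [(chart p).open_target.mem_nhds (chart_mem p)] with y hy
  exact (fderiv_param_localField p X hy).symm

theorem lift_chart_symm (p : S6) (X : ∀ q : S6, TangentSpace (𝓡 6) q) :
    lift X ((chart p).symm (chart p p)) = dIota p (X p) :=
  congrArg (lift X) ((chart p).left_inv (mem_chart_source _ p))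

theorem param_chart (p : S6) : param (chart p) (chart p p) = normal p :=
  congrArg Subtype.val ((chart p).left_inv (mem_chart_source _ p))

theorem mlieBracket_eq (p : S6) (X Y : ∀ q : S6, TangentSpace (𝓡 6) q) :
    VectorField.mlieBracket (𝓡 6) X Y p =
    fderiv ℝ (localField p Y) (chart p p) (X p) - fderiv ℝ (localField p X) (chart p p) (Y p) := by
  have hid : (mfderiv (𝓡 6) 𝓘(ℝ, EuclideanSpace ℝ (Fin 6)) (extChartAt (𝓡 6) p) p).inverse =
      ContinuousLinearMap.id ℝ (EuclideanSpace ℝ (Fin 6)) := by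
    rw [mfderiv_extChartAt_self]
    exact ContinuousLinearMap.inverse_id
  rw [← VectorField.mlieBracketWithin_univ, VectorField.mlieBracketWithin_apply,
    chart_preimage_eq_univ]
  refine (DFunLike.congr_fun hid _).trans ?_
  change fderivWithin ℝ (localField p Y) Set.univ (chart p p) (localField p X (chart p p))
    - fderivWithin ℝ (localField p X) Set.univ (chart p p) (localField p Y (chart p p)) = _
  rw [fderivWithin_univ, fderivWithin_univ, localField_self, localField_self]

section Lift

variable {p : S6} {X Y : ∀ q : S6, TangentSpace (𝓡 6) q} (hX : IsDiffVectorFieldAt X p)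
  (hY : IsDiffVectorFieldAt Y p)

theorem differentiableAt_fderiv_param (p : S6) :
    DifferentiableAt ℝ (fderiv ℝ (param (chart p))) (chart p p) :=
  ((contDiffOn_fderiv_param (chartAt_mem p)).contDiffAt
    ((chart p).open_target.mem_nhds (chart_mem p))).differentiableAt (by simp)

include hX

theorem hasFDerivAt_lift : HasFDerivAt (lift X ∘ (chart p).symm)
    ((fderiv ℝ (param (chart p)) (chart p p)).comp (fderiv ℝ (localField p X) (chart p p)) +
      (fderiv ℝ (fderiv ℝ (param (chart p))) (chart p p)).flip (X p)) (chart p p) := by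
  have h := (differentiableAt_fderiv_param p).hasFDerivAt.clm_apply
    (differentiableAt_localField hX).hasFDerivAt
  rw [localField_self] at h
  exact h.congr_of_eventuallyEq (lift_comp_chart_symm_eventuallyEq p X)

theorem differentiableAt_lift : DifferentiableAt ℝ (lift X ∘ (chart p).symm) (chart p p) :=
  (hasFDerivAt_lift hX).differentiableAt

theorem mdifferentiableAt_lift : MDifferentiableAt (𝓡 6) 𝓘(ℝ, E7) (lift X) p :=
  mdifferentiableAt_iff_chart.2 (differentiableAt_lift hX)

theorem mvfderiv_lift (v : TangentSpace (𝓡 6) p) : mvfderiv (𝓡 6) (lift X) p v =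
    dIota p (fderiv ℝ (localField p X) (chart p p) v) +
      fderiv ℝ (fderiv ℝ (param (chart p))) (chart p p) v (X p) := by
  rw [mvfderiv_eq_fderiv (mdifferentiableAt_lift hX), (hasFDerivAt_lift hX).fderiv]
  exact congrArg (· + _) (fderiv_param_chart p _)

include hY

/-- The second derivative of `param (chart p)` is symmetric and cancels, leaving the bracket of the
chart expressions. This is the torsion-freeness. -/
theorem mvfderiv_lift_sub : mvfderiv (𝓡 6) (lift Y) p (X p) - mvfderiv (𝓡 6) (lift X) p (Y p) =
    dIota p (VectorField.mlieBracket (𝓡 6) X Y p) := by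
  have hs : IsSymmSndFDerivAt ℝ (param (chart p)) (chart p p) :=
    (contDiffAt_param (chartAt_mem p) (chart_mem p)).isSymmSndFDerivAt
      (by
        rw [minSmoothness_of_isRCLikeNormedField]
        exact WithTop.coe_le_coe.2 (le_top : (2 : ℕ∞) ≤ ⊤))
  rw [mvfderiv_lift hX, mvfderiv_lift hY, mlieBracket_eq]
  refine Eq.trans ?_ ((dIota p).map_sub _ _).symm
  rw [hs.eq (X p) (Y p)]
  abel

theorem mdifferentiableAt_metric :
    MDifferentiableAt (𝓡 6) 𝓘(ℝ, ℝ) (fun q => g q (X q) (Y q)) p :=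
  mdifferentiableAt_iff_chart.2
    ((differentiableAt_lift hX).inner ℝ (differentiableAt_lift hY))

theorem mvfderiv_metric (v : TangentSpace (𝓡 6) p) :
    mvfderiv (𝓡 6) (fun q => g q (X q) (Y q)) p v =
      inner ℝ (mvfderiv (𝓡 6) (lift X) p v) (dIota p (Y p)) +
        inner ℝ (dIota p (X p)) (mvfderiv (𝓡 6) (lift Y) p v) := by
  have h : HasFDerivAt ((fun q => g q (X q) (Y q)) ∘ (chart p).symm) _ (chart p p) :=
    (differentiableAt_lift hX).hasFDerivAt.inner ℝ (differentiableAt_lift hY).hasFDerivAt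
  rw [mvfderiv_eq_fderiv (mdifferentiableAt_metric hX hY), h.fderiv,
    mvfderiv_eq_fderiv (mdifferentiableAt_lift hX), mvfderiv_eq_fderiv (mdifferentiableAt_lift hY)]
  rw [← lift_chart_symm p X, ← lift_chart_symm p Y, add_comm]
  rfl

end Lift

/-- The Levi-Civita connection of the sphere: the tangential part of the derivative in `ℝ⁷`. -/
def leviCivita : CovariantDerivative (𝓡 6) (EuclideanSpace ℝ (Fin 6))
    (TangentSpace (𝓡 6) : S6 → Type _) where
  toFun X p := tangentProj p ∘L mvfderiv (𝓡 6) (lift X) p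
  isCovariantDerivativeOnUniv :=
    { add := fun {X Y p} hX hY _ => by
        have h : lift (X + Y) = lift X + lift Y := funext fun q => (dIota q).map_add _ _
        rw [h, mvfderiv_add (mdifferentiableAt_lift hX) (mdifferentiableAt_lift hY),
          ContinuousLinearMap.comp_add]
      leibniz := fun {X f p} hX hf _ => by
        have h : lift (f • X) = f • lift X := funext fun q => (dIota q).map_smul _ _
        rw [h, mvfderiv_smul hf (mdifferentiableAt_lift hX)]
        ext1 v
        change tangentProj p (f p • mvfderiv (𝓡 6) (lift X) p v +
          mvfderiv (𝓡 6) f p v • dIota p (X p)) = f p • tangentProj p (mvfderiv (𝓡 6) (lift X) p v)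
            + mvfderiv (𝓡 6) f p v • X p
        rw [map_add, map_smul, map_smul, tangentProj_dIota] }

theorem leviCivita_apply (X : ∀ q : S6, TangentSpace (𝓡 6) q) (p : S6)
    (v : TangentSpace (𝓡 6) p) :
    leviCivita X p v = tangentProj p (mvfderiv (𝓡 6) (lift X) p v) := rfl

theorem inner_tangentProj (p : S6) (x : E7) (v : TangentSpace (𝓡 6) p) :
    (inner ℝ (dIota p (tangentProj p x)) (dIota p v) : ℝ) = inner ℝ x (dIota p v) := by
  rw [dIota_tangentProj, inner_sub_left, inner_smul_left, inner_dIota, mul_zero, sub_zero]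

theorem isLeviCivita : IsLeviCivita (n := 6) (M := S6) g leviCivita where
  torsion_free := by
    rw [CovariantDerivative.torsion_eq_zero_iff]
    intro X Y p hX hY
    rw [leviCivita_apply, leviCivita_apply, ← map_sub, mvfderiv_lift_sub hX hY, tangentProj_dIota]
  metric X Y p hX hY v := by
    rw [mvfderiv_metric hX hY, g_apply, g_apply, leviCivita_apply, leviCivita_apply,
      inner_tangentProj, real_inner_comm (dIota p (tangentProj p _)), inner_tangentProj,
      real_inner_comm (dIota p (X p))]

/-! ### The nearly Kähler condition. -/

theorem lift_J (X : ∀ q : S6, TangentSpace (𝓡 6) q) :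
    lift (fun q => J q (X q)) = fun q => crossCLM (normal q) (lift X q) :=
  funext fun q => dIota_J q (X q)

/-- Product rule for N × X, with dN = dι. -/
theorem mvfderiv_lift_J {X : ∀ q : S6, TangentSpace (𝓡 6) q} {p : S6}
    (hX : IsDiffVectorFieldAt X p) (v : TangentSpace (𝓡 6) p) :
    mvfderiv (𝓡 6) (lift fun q => J q (X q)) p v =
      cross (dIota p v) (dIota p (X p)) + cross (normal p) (mvfderiv (𝓡 6) (lift X) p v) := by
  have h1 : HasFDerivAt (param (chart p)) (fderiv ℝ (param (chart p)) (chart p p)) (chart p p) :=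
    ((contDiffAt_param (chartAt_mem p) (chart_mem p)).differentiableAt (by simp)).hasFDerivAt
  have h0 : HasFDerivAt (fun y => crossCLM (param (chart p) y))
      (crossCLM.comp (fderiv ℝ (param (chart p)) (chart p p))) (chart p p) :=
    (ContinuousLinearMap.hasFDerivAt crossCLM).comp (chart p p) h1
  have hJ : (lift fun q => J q (X q)) ∘ (chart p).symm =
      fun y => crossCLM (param (chart p) y) ((lift X ∘ (chart p).symm) y) := by
    rw [lift_J]
    rfl
  have h2 := h0.clm_apply (differentiableAt_lift hX).hasFDerivAt
  rw [← hJ] at h2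
  rw [mvfderiv_eq_fderiv (mdifferentiableAt_iff_chart.2 h2.differentiableAt), h2.fderiv,
    mvfderiv_eq_fderiv (mdifferentiableAt_lift hX), ← lift_chart_symm, ← fderiv_param_chart,
    ← param_chart, add_comm]
  rfl

theorem isNearlyKahler : IsNearlyKahler (n := 6) (M := S6) g J where
  almostHermitian := isAlmostHermitian
  skew := by
    refine ⟨leviCivita, isLeviCivita, fun X p hX => ?_⟩
    rw [sub_eq_zero]
    apply dIota_injective p
    -- X × X = 0, N × D_X X is already tangent, and the normal part of D_X X is killed by N ×.
    rw [dIota_J, leviCivita_apply, leviCivita_apply, dIota_tangentProj, dIota_tangentProj,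
      mvfderiv_lift_J hX, cross_self, zero_add, inner_cross_self_left, zero_smul, sub_zero, map_sub,
      map_smul, cross_self, smul_zero, sub_zero]

end NearlyKahlerSphere

end

theorem mainTheorem8 :
    NearlyKahlerSphere.IsSU3Structure NearlyKahlerSphere.g NearlyKahlerSphere.J
      NearlyKahlerSphere.sigma NearlyKahlerSphere.psiPlus NearlyKahlerSphere.psiMinus ∧
    (∀ p : NearlyKahlerSphere.S6,
      NearlyKahlerSphere.extD NearlyKahlerSphere.sigma p = (3 : ℝ) • NearlyKahlerSphere.psiPlus p) ∧
    (∀ p : NearlyKahlerSphere.S6,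
      NearlyKahlerSphere.extD NearlyKahlerSphere.psiMinus p = (-2 : ℝ) •
        NearlyKahlerSphere.wedge (NearlyKahlerSphere.sigma p) (NearlyKahlerSphere.sigma p)) ∧
    NearlyKahlerSphere.IsNearlyKahler NearlyKahlerSphere.g NearlyKahlerSphere.J :=
  ⟨NearlyKahlerSphere.isSU3Structure, NearlyKahlerSphere.extD_sigma,
    NearlyKahlerSphere.extD_psiMinus, NearlyKahlerSphere.isNearlyKahler⟩
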